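/- Let $A_1,A_2$ be unital C*-algebras with a common unital C*-subalgebra $B\subset A_k$ and conditional expectations $E_k:A_k\to B$ ($k=1,2$), i.e. unital completely positive $B$-bimodule maps with $E_k|_B=\mathrm{id}_B$. For $k\in\{1,2\}$ let $\bar k$ be the other index, and let $A_f=A_1*_BA_2$ be the full (universal) amalgamated free product. *Definitions.* Let $(K_k,\rho_k,\eta_k)$ be the GNS construction of $E_k$: $K_k$ is a Hilbert $B$-module, $\rho_k:A_k\to\mathcal L_B(K_k)$ a unital $*$-homomorphism, $K_k=\overline{\rho_k(A_k)\eta_k\cdot B}$ and $\langle\eta_k,\rho_k(a)\eta_k\rangle=E_k(a)$. Let $K_k^\circ\subset K_k$ be the closed submodule generated by the $\rho_k(a)\eta_k$ with $E_k(a)=0$. For a word $\underline i=(i_1,\dots,i_n)$, $n\ge1$, in the letters $1,2$ with $i_r\ne i_{r+1}$ for all $r$, let $$H_{\underline i}=\begin{cases}A_{i_1}&n=1,\\ K_{i_1}\otimes_BA_{i_2}&n=2,\\ K_{i_1}\otimes_BK_{i_2}^\circ\otimes_B\cdots\otimes_BK_{i_{n-1}}^\circ\otimes_BA_{i_n}&n\ge3,\end{cases}$$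 a Hilbert $A_{i_n}$-module on which $A_{i_1}$ acts on the left (by left multiplication if $n=1$, by $\rho_{i_1}\otimes\mathrm{id}$ if $n\ge2$). Let $H_{k,l}$ be the direct sum of all the $H_{\underline i}$ with $i_1=k$, $i_n=l$, and let $\lambda_{k,l}:A_k\to\mathcal L_{A_l}(H_{k,l})$ be the direct sum of the left actions. Let $u_{k,l}:H_{k,l}\to H_{\bar k,l}$ be the unitary defined on $\xi\in H_{\underline i}$ as follows: if $n=1$, then $u_{k,l}\xi=\eta_{\bar k}\otimes\xi$; if $n\ge2$ and $\xi=\rho_k(a)\eta_k\otimes\xi'$, then $u_{k,l}\xi=\eta_{\bar k}\otimes\xi$ if $E_k(a)=0$, and $u_{k,l}\xi=\lambda_{\bar k,l}(a)\xi'$ if $a\in B$. It satisfies $u_{k,l}^*=u_{\bar k,l}$ and $u_{k,l}^*\lambda_{\bar k,l}(b)u_{k,l}=\lambda_{k,l}(b)$ for $b\in B$. Let $\pi_k:A_f\to\mathcal L_{A_k}(H_{k,k})$ be the unital $*$-homomorphism with $\pi_k(a)=\lambda_{k,k}(a)$ for $a\in A_k$ and $\pi_k(a)=u_{k,k}^*\lambda_{\bar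 k,k}(a)u_{k,k}$ for $a\in A_{\bar k}$. The *vertex-reduced amalgamated free product* $A_v$ is the C*-algebra obtained by separation and completion of $A_f$ with respect to the C*-seminorm $\|x\|_v=\max(\|\pi_1(x)\|,\|\pi_2(x)\|)$. Let $\pi:A_f\to A_v$ be the canonical $*$-homomorphism. **Statement.** Suppose that $E_1$ and $E_2$ are $*$-homomorphisms, and let $$A_1\oplus_BA_2=\{(a_1,a_2)\in A_1\oplus A_2 : E_1(a_1)=E_2(a_2)\}.$$ Then $A_v$ is canonically isomorphic to $A_1\oplus_BA_2$: there is exactly one $*$-isomorphism $\varphi:A_v\to A_1\oplus_BA_2$ such that $$\varphi(\pi(a))=(a,E_1(a))\ \text{ for all }a\in A_1,\qquad \varphi(\pi(a))=(E_2(a),a)\ \text{ for all }a\in A_2.$$ -/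

import Mathlib

set_option linter.unusedSectionVars false
/-! ## C*-seminorms and the associated C*-algebras -/

/-- A C*-seminorm on a complex unital `*`-algebra. -/
structure CStarSeminorm (P : Type*) [Ring P] [Algebra ℂ P] [StarRing P] extends
    Seminorm ℂ P where
  mul_le' : ∀ x y : P, toFun (x * y) ≤ toFun x * toFun y
  star_mul_self' : ∀ x : P, toFun (star x * x) = toFun x * toFun x

namespace CStarSeminorm

variable {P : Type*} [Ring P] [Algebra ℂ P] [StarRing P]

noncomputable instance : CoeFun (CStarSeminorm P) (fun _ => P → ℝ) := ⟨fun p => p.toSeminorm⟩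

theorem mul_le (p : CStarSeminorm P) (x y : P) : p (x * y) ≤ p x * p y := p.mul_le' x y

theorem star_mul_self (p : CStarSeminorm P) (x : P) : p (star x * x) = p x * p x :=
  p.star_mul_self' x

theorem le_star (p : CStarSeminorm P) (x : P) : p x ≤ p (star x) := by
  have h0 : 0 ≤ p x := apply_nonneg p.toSeminorm x
  have h1 := p.mul_le (star x) x
  rw [p.star_mul_self] at h1
  rcases h0.eq_or_lt with h | h
  · rw [← h]; exact apply_nonneg p.toSeminorm _
  · exact le_of_mul_le_mul_right h1 h

theorem map_star (p : CStarSeminorm P) (x : P) : p (star x) = p x :=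
  le_antisymm (by simpa using p.le_star (star x)) (p.le_star x)

/-- The `*`-algebra `P`, regarded as a seminormed algebra through `p`. -/
def Carrier (_ : CStarSeminorm P) : Type _ := P

variable (p : CStarSeminorm P)

instance instRingCarrier : Ring p.Carrier := inferInstanceAs (Ring P)

/-- The seminorm `p` on the carrier. -/
noncomputable def carrierSeminorm : RingSeminorm p.Carrier where
  toFun := p
  map_zero' := map_zero p.toSeminorm
  add_le' := map_add_le_add p.toSeminorm
  neg' := map_neg_eq_map p.toSeminorm
  mul_le' := p.mul_le

noncomputable instance : SeminormedRing p.Carrier := p.carrierSeminorm.toSeminormedRing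

instance : Algebra ℂ p.Carrier := inferInstanceAs (Algebra ℂ P)
instance : StarRing p.Carrier := inferInstanceAs (StarRing P)
instance [StarModule ℂ P] : StarModule ℂ p.Carrier := inferInstanceAs (StarModule ℂ P)

/-- The element of the seminormed algebra given by an element of `P`. -/
def toCarrier (x : P) : p.Carrier := x

noncomputable instance : NormedAlgebra ℂ p.Carrier where
  norm_smul_le c x := (map_smul_eq_mul p.toSeminorm c x).le

theorem norm_toCarrier (x : P) : ‖p.toCarrier x‖ = p x := rfl

noncomputable instance : NormedStarGroup p.Carrier where
  norm_star_le x := (p.map_star x).le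

/-- The C*-algebra obtained from `P` by separation and completion with respect to the
C*-seminorm `p`. -/
def Completion : Type _ := UniformSpace.Completion p.Carrier

noncomputable instance : NormedRing p.Completion :=
  inferInstanceAs (NormedRing (UniformSpace.Completion p.Carrier))

instance : CompleteSpace p.Completion :=
  inferInstanceAs (CompleteSpace (UniformSpace.Completion p.Carrier))

noncomputable instance : Algebra ℂ p.Completion :=
  inferInstanceAs (Algebra ℂ (UniformSpace.Completion p.Carrier))

noncomputable instance : NormedAlgebra ℂ p.Completion where
  norm_smul_le c x := norm_smul_le (α := ℂ) (β := UniformSpace.Completion p.Carrier) c x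

/-- The canonical map of `P` to the completion, as a function. -/
noncomputable def coe (x : P) : p.Completion := ((p.toCarrier x : p.Carrier) : UniformSpace.Completion p.Carrier)

theorem norm_coe (x : P) : ‖p.coe x‖ = p x :=
  UniformSpace.Completion.norm_coe (E := p.Carrier) x

theorem denseRange_coe : DenseRange p.coe :=
  UniformSpace.Completion.denseRange_coe (α := p.Carrier)

theorem coe_mul (x y : P) : p.coe (x * y) = p.coe x * p.coe y :=
  UniformSpace.Completion.coe_mul (α := p.Carrier) x y

theorem coe_add (x y : P) : p.coe (x + y) = p.coe x + p.coe y :=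
  UniformSpace.Completion.coe_add (α := p.Carrier) x y

theorem coe_smul (c : ℂ) (x : P) : p.coe (c • x) = c • p.coe x :=
  UniformSpace.Completion.coe_smul (X := p.Carrier) c x

theorem coe_one : p.coe 1 = 1 := rfl

theorem coe_algebraMap (c : ℂ) : p.coe (algebraMap ℂ P c) = algebraMap ℂ p.Completion c := rfl

noncomputable instance : Star p.Completion :=
  ⟨UniformSpace.Completion.map (star : p.Carrier → p.Carrier)⟩

theorem continuous_star' : Continuous (star : p.Completion → p.Completion) :=
  UniformSpace.Completion.continuous_map

theorem coe_star (x : P) : p.coe (star x) = star (p.coe x) :=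
  (UniformSpace.Completion.map_coe (α := p.Carrier) (β := p.Carrier)
    (star_isometry (E := p.Carrier)).uniformContinuous x).symm

theorem induction {Q : p.Completion → Prop} (hQ : IsClosed {x | Q x}) (h : ∀ x, Q (p.coe x))
    (x : p.Completion) : Q x :=
  UniformSpace.Completion.induction_on (α := p.Carrier) x hQ h

theorem induction₂ {Q : p.Completion → p.Completion → Prop}
    (hQ : IsClosed {x : p.Completion × p.Completion | Q x.1 x.2})
    (h : ∀ x y, Q (p.coe x) (p.coe y)) (x y : p.Completion) : Q x y :=
  UniformSpace.Completion.induction_on₂ (α := p.Carrier) (β := p.Carrier) x y hQ h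

noncomputable instance : StarRing p.Completion where
  star_involutive x := by
    have hc := p.continuous_star'
    refine p.induction (Q := fun x => star (star x) = x)
      (isClosed_eq (hc.comp hc) continuous_id) (fun y => ?_) x
    rw [← coe_star, ← coe_star, star_star]
  star_mul x y := by
    have hc := p.continuous_star'
    refine p.induction₂ (Q := fun x y => star (x * y) = star y * star x)
      (isClosed_eq (hc.comp (continuous_fst.mul continuous_snd))
        ((hc.comp continuous_snd).mul (hc.comp continuous_fst))) (fun x y => ?_) x y
    simp only [← coe_star, ← coe_mul, star_mul]
  star_add x y := by
    have hc := p.continuous_star'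
    refine p.induction₂ (Q := fun x y => star (x + y) = star x + star y)
      (isClosed_eq (hc.comp (continuous_fst.add continuous_snd))
        ((hc.comp continuous_fst).add (hc.comp continuous_snd))) (fun x y => ?_) x y
    simp only [← coe_star, ← coe_add, star_add]

instance [StarModule ℂ P] : StarModule ℂ p.Completion where
  star_smul c x := by
    have hc := p.continuous_star'
    refine p.induction (Q := fun x => star (c • x) = star c • star x)
      (isClosed_eq (hc.comp (continuous_const_smul c)) ((continuous_const_smul (star c)).comp hc)) (fun y => ?_) x
    simp only [← coe_star, ← coe_smul, star_smul]

instance : CStarRing p.Completion where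
  norm_mul_self_le x := by
    have hc := p.continuous_star'
    refine p.induction (Q := fun x => ‖x‖ * ‖x‖ ≤ ‖star x * x‖)
      (isClosed_le (by fun_prop) ((hc.mul continuous_id).norm)) (fun y => ?_) x
    simp only [← coe_star, ← coe_mul, norm_coe, star_mul_self, le_refl]

noncomputable instance [StarModule ℂ P] : CStarAlgebra p.Completion where

/-- The canonical unital `*`-homomorphism, with dense range, of `P` to the completion. -/
noncomputable def toCompletion : P →⋆ₐ[ℂ] p.Completion where
  toFun := p.coe
  map_one' := rfl
  map_mul' := p.coe_mul
  map_zero' := rfl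
  map_add' := p.coe_add
  commutes' _ := rfl
  map_star' := p.coe_star

section lift

variable {p}
variable {C : Type*} [CStarAlgebra C]

/-- A dominated `*`-homomorphism as a continuous linear map on the carrier. -/
noncomputable def liftAux (f : P →⋆ₐ[ℂ] C) (hf : ∀ x, ‖f x‖ ≤ p x) : p.Carrier →L[ℂ] C :=
  LinearMap.mkContinuous (f.toAlgHom.toLinearMap : P →ₗ[ℂ] C) 1
    (fun x => by rw [one_mul]; exact hf x)

/-- A unital `*`-homomorphism to a C*-algebra that is dominated by `p` extends to the completion. -/
noncomputable def lift (f : P →⋆ₐ[ℂ] C) (hf : ∀ x, ‖f x‖ ≤ p x) : p.Completion →⋆ₐ[ℂ] C :=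
  let G : p.Completion →L[ℂ] C := (liftAux f hf).fromCompletion
  have hG : ∀ x : P, G (p.coe x) = f x := (liftAux f hf).fromCompletion_apply_coe
  { toFun := G
    map_one' := by rw [← coe_one, hG, map_one]
    map_mul' := p.induction₂ (isClosed_eq (by fun_prop) (by fun_prop))
      fun x y => by rw [← coe_mul, hG, hG, hG, map_mul]
    map_zero' := map_zero G
    map_add' := map_add G
    commutes' := fun c => by rw [← coe_algebraMap, hG, AlgHomClass.commutes]
    map_star' := p.induction
      (isClosed_eq (G.continuous.comp p.continuous_star') (G.continuous.star))
      fun x => by rw [← coe_star, hG, hG, StarHomClass.map_star] }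

theorem lift_toCompletion (f : P →⋆ₐ[ℂ] C) (hf : ∀ x, ‖f x‖ ≤ p x) (x : P) :
    lift f hf (p.toCompletion x) = f x :=
  (liftAux f hf).fromCompletion_apply_coe x

/-- The C*-seminorm `x ↦ ‖f x‖` of a unital `*`-homomorphism to a C*-algebra. -/
noncomputable def ofHom (f : P →⋆ₐ[ℂ] C) : CStarSeminorm P where
  toSeminorm := (normSeminorm ℂ C).comp f.toAlgHom.toLinearMap
  mul_le' x y := by
    change ‖f (x * y)‖ ≤ ‖f x‖ * ‖f y‖
    rw [map_mul]; exact norm_mul_le _ _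
  star_mul_self' x := by
    change ‖f (star x * x)‖ = ‖f x‖ * ‖f x‖
    rw [map_mul, StarHomClass.map_star, CStarRing.norm_star_mul_self]

theorem ofHom_apply (f : P →⋆ₐ[ℂ] C) (x : P) : ofHom f x = ‖f x‖ := rfl

end lift

theorem ext_apply {p q : CStarSeminorm P} (h : ∀ x, p x = q x) : p = q := by
  obtain ⟨p, hp, hp'⟩ := p
  obtain ⟨q, hq, hq'⟩ := q
  have : p = q := Seminorm.ext h
  subst this; rfl

/-- The pointwise supremum of a non-empty, pointwise bounded family of C*-seminorms. -/
noncomputable def iSup {ι : Type*} [Nonempty ι] (p : ι → CStarSeminorm P)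
    (hp : ∀ x, BddAbove (Set.range fun i => p i x)) : CStarSeminorm P where
  toFun x := ⨆ i, p i x
  map_zero' := by simp
  add_le' x y := ciSup_le fun i => (map_add_le_add (p i).toSeminorm x y).trans
    (add_le_add (le_ciSup (hp x) i) (le_ciSup (hp y) i))
  neg' x := by simp
  smul' c x := by simp [map_smul_eq_mul, Real.mul_iSup_of_nonneg (norm_nonneg c)]
  mul_le' x y := ciSup_le fun i => ((p i).mul_le x y).trans
    (mul_le_mul (le_ciSup (hp x) i) (le_ciSup (hp y) i) (apply_nonneg (p i).toSeminorm y)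
      (Real.iSup_nonneg fun i => apply_nonneg (p i).toSeminorm x))
  star_mul_self' x := by
    have h0 : ∀ i, 0 ≤ p i x := fun i => apply_nonneg (p i).toSeminorm x
    have h1 : 0 ≤ ⨆ i, p i x := Real.iSup_nonneg h0
    refine le_antisymm (ciSup_le fun i => ?_) ?_
    · rw [star_mul_self]
      exact mul_le_mul (le_ciSup (hp x) i) (le_ciSup (hp x) i) (h0 i) h1
    · have h2 : ⨆ i, p i x ≤ √(⨆ i, p i (star x * x)) := ciSup_le fun i => by
        refine Real.le_sqrt_of_sq_le ?_
        rw [sq, ← star_mul_self]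
        exact le_ciSup (hp (star x * x)) i
      have h3 : 0 ≤ ⨆ i, p i (star x * x) :=
        Real.iSup_nonneg fun i => apply_nonneg (p i).toSeminorm _
      calc _ ≤ √(⨆ i, p i (star x * x)) * √(⨆ i, p i (star x * x)) :=
            mul_le_mul h2 h2 h1 (Real.sqrt_nonneg _)
        _ = _ := Real.mul_self_sqrt h3

/-- The pointwise maximum of two C*-seminorms. -/
noncomputable def sup (p q : CStarSeminorm P) : CStarSeminorm P where
  toSeminorm := p.toSeminorm ⊔ q.toSeminorm
  mul_le' x y := by
    change max (p (x * y)) (q (x * y)) ≤ max (p x) (q x) * max (p y) (q y)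
    refine max_le ((p.mul_le x y).trans ?_) ((q.mul_le x y).trans ?_)
    · exact mul_le_mul (le_max_left _ _) (le_max_left _ _) (apply_nonneg p.toSeminorm _)
        (le_max_of_le_left (apply_nonneg p.toSeminorm _))
    · exact mul_le_mul (le_max_right _ _) (le_max_right _ _) (apply_nonneg q.toSeminorm _)
        (le_max_of_le_left (apply_nonneg p.toSeminorm _))
  star_mul_self' x := by
    change max (p (star x * x)) (q (star x * x)) = max (p x) (q x) * max (p x) (q x)
    rw [star_mul_self, star_mul_self]
    have hp : 0 ≤ p x := apply_nonneg p.toSeminorm x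
    have hq : 0 ≤ q x := apply_nonneg q.toSeminorm x
    rcases le_total (p x) (q x) with h | h
    · rw [max_eq_right h, max_eq_right (mul_self_le_mul_self hp h)]
    · rw [max_eq_left h, max_eq_left (mul_self_le_mul_self hq h)]

theorem sup_apply (p q : CStarSeminorm P) (x : P) : sup p q x = max (p x) (q x) := rfl

end CStarSeminorm

/-! ## The C*-algebra of adjointable operators of a Hilbert module

Mathlib's `CStarModule A E` has the coefficients on the left, `inner A x (a • y) = a * inner A x y`,
so a right Hilbert `A`-module is a `CStarModule Aᵐᵒᵖ E`. -/

section Adjointable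

variable (A E : Type*) [CStarAlgebra A] [PartialOrder A] [StarOrderedRing A]
  [NormedAddCommGroup E] [NormedSpace ℂ E] [SMul A E] [CStarModule A E]

/-- The adjointable operators of the Hilbert `A`-module `E`, as a subalgebra of the bounded
operators. -/
def adjointableSubalgebra : Subalgebra ℂ (E →L[ℂ] E) where
  carrier := {T | ∃ S : E →L[ℂ] E, ∀ x y : E, inner A (T x) y = inner A x (S y)}
  mul_mem' := by
    rintro T T' ⟨S, hS⟩ ⟨S', hS'⟩
    exact ⟨S' * S, fun x y => by simp [hS, hS']⟩
  add_mem' := by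
    rintro T T' ⟨S, hS⟩ ⟨S', hS'⟩
    exact ⟨S + S', fun x y => by simp [hS, hS']⟩
  algebraMap_mem' c := ⟨algebraMap ℂ _ (star c), fun x y => by
    simp [Algebra.algebraMap_eq_smul_one]⟩

/-- The algebra of adjointable operators of the Hilbert `A`-module `E`, with the operator norm. -/
def Adjointable : Type _ := adjointableSubalgebra A E

noncomputable instance : NormedRing (Adjointable A E) :=
  inferInstanceAs (NormedRing (adjointableSubalgebra A E))

noncomputable instance : NormedAlgebra ℂ (Adjointable A E) :=
  inferInstanceAs (NormedAlgebra ℂ (adjointableSubalgebra A E))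

variable {A E}

theorem CStarModule.ext_inner {x y : E} (h : ∀ z : E, inner A x z = inner A y z) : x = y := by
  rw [← sub_eq_zero, ← CStarModule.inner_self (A := A)]
  rw [CStarModule.inner_sub_left, h, sub_self]

theorem CStarModule.ext_inner_right {x y : E} (h : ∀ z : E, inner A z x = inner A z y) :
    x = y :=
  CStarModule.ext_inner (A := A) fun z => by
    rw [← CStarModule.star_inner z x, h, CStarModule.star_inner]

namespace Adjointable

theorem ext_apply {S T : Adjointable A E} (h : ∀ x, S.1 x = T.1 x) : S = T :=
  Subtype.ext (ContinuousLinearMap.ext h)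

/-- The adjoint of an adjointable operator. -/
noncomputable def adj (T : Adjointable A E) : E →L[ℂ] E := T.2.choose

theorem inner_adj (T : Adjointable A E) (x y : E) : inner A (T.1 x) y = inner A x (adj T y) :=
  T.2.choose_spec x y

theorem inner_adj' (T : Adjointable A E) (x y : E) : inner A (adj T x) y = inner A x (T.1 y) := by
  rw [← CStarModule.star_inner, ← inner_adj, CStarModule.star_inner]

noncomputable instance : Star (Adjointable A E) :=
  ⟨fun T => ⟨adj T, T.1, inner_adj' T⟩⟩

theorem inner_left (T : Adjointable A E) (x y : E) :
    inner A (T.1 x) y = inner A x ((star T).1 y) :=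
  inner_adj T x y

theorem star_eq_of_inner {T S : Adjointable A E}
    (h : ∀ x y, inner A (T.1 x) y = inner A x (S.1 y)) : star T = S :=
  ext_apply fun y => CStarModule.ext_inner_right (A := A) fun x => by rw [← inner_left, h]

theorem inner_right (T : Adjointable A E) (x y : E) :
    inner A x (T.1 y) = inner A ((star T).1 x) y :=
  (inner_adj' T x y).symm

noncomputable instance : StarRing (Adjointable A E) where
  star_involutive T := star_eq_of_inner fun x y => (inner_right T x y).symm
  star_mul T S := star_eq_of_inner fun x y => by
    change inner A (T.1 (S.1 x)) y = inner A x ((star S).1 ((star T).1 y))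
    rw [inner_left, inner_left]
  star_add T S := star_eq_of_inner fun x y => by
    change inner A (T.1 x + S.1 x) y = inner A x ((star T).1 y + (star S).1 y)
    rw [CStarModule.inner_add_left, CStarModule.inner_add_right, inner_left, inner_left]

instance : StarModule ℂ (Adjointable A E) where
  star_smul c T := star_eq_of_inner fun x y => by
    change inner A (c • T.1 x) y = inner A x (star c • (star T).1 y)
    rw [CStarModule.inner_smul_left_complex, CStarModule.inner_smul_right_complex, inner_left]

theorem norm_apply_sq (T : Adjointable A E) (x : E) :
    ‖T.1 x‖ ^ 2 ≤ ‖star T * T‖ * ‖x‖ ^ 2 := by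
  rw [CStarModule.norm_sq_eq A, inner_left]
  calc _ ≤ ‖x‖ * ‖(star T * T).1 x‖ := CStarModule.norm_inner_le E
    _ ≤ ‖x‖ * (‖star T * T‖ * ‖x‖) := by
        gcongr
        exact (star T * T).1.le_opNorm x
    _ = _ := by ring

instance : CStarRing (Adjointable A E) where
  norm_mul_self_le T := by
    have h : ‖T.1‖ ≤ √‖star T * T‖ := by
      refine T.1.opNorm_le_bound (Real.sqrt_nonneg _) fun x => ?_
      refine (sq_le_sq₀ (norm_nonneg _) (by positivity)).1 ?_
      rw [mul_pow, Real.sq_sqrt (norm_nonneg _)]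
      exact norm_apply_sq T x
    calc ‖T‖ * ‖T‖ ≤ √‖star T * T‖ * √‖star T * T‖ := mul_self_le_mul_self (norm_nonneg _) h
      _ = _ := Real.mul_self_sqrt (norm_nonneg _)

instance [CompleteSpace E] : CompleteSpace (Adjointable A E) := by
  refine Metric.complete_of_cauchySeq_tendsto fun u hu => ?_
  have hn : ∀ T : Adjointable A E, ‖star T‖ = ‖T‖ := fun T => norm_star T
  have hv : CauchySeq fun n => star (u n) := by
    refine Metric.cauchySeq_iff'.2 fun ε hε => ?_
    obtain ⟨N, hN⟩ := Metric.cauchySeq_iff'.1 hu ε hε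
    exact ⟨N, fun n h => by rw [dist_eq_norm, ← star_sub, hn, ← dist_eq_norm]; exact hN n h⟩
  have hc : UniformContinuous (Subtype.val : Adjointable A E → (E →L[ℂ] E)) :=
    uniformContinuous_subtype_val (p := fun T => T ∈ adjointableSubalgebra A E)
  obtain ⟨T, hT⟩ := cauchySeq_tendsto_of_complete (hc.comp_cauchySeq hu)
  obtain ⟨S, hS⟩ := cauchySeq_tendsto_of_complete (hc.comp_cauchySeq hv)
  refine ⟨⟨T, S, fun x y => ?_⟩, tendsto_subtype_rng.2 hT⟩
  have h1 : Filter.Tendsto (fun n => inner A ((u n).1 x) y) Filter.atTop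
      (nhds (inner A (T x) y)) := by
    have := ((ContinuousLinearMap.apply ℂ E x).continuous.tendsto T).comp hT
    exact ((CStarModule.continuous_inner (A := A) (E := E)).tendsto (T x, y)).comp
      (this.prodMk_nhds tendsto_const_nhds)
  have h2 : Filter.Tendsto (fun n => inner A x ((star (u n)).1 y)) Filter.atTop
      (nhds (inner A x (S y))) := by
    have := ((ContinuousLinearMap.apply ℂ E y).continuous.tendsto S).comp hS
    exact ((CStarModule.continuous_inner (A := A) (E := E)).tendsto (x, S y)).comp
      (tendsto_const_nhds.prodMk_nhds this)
  refine tendsto_nhds_unique h1 (h2.congr fun n => ?_)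
  exact (inner_left (u n) x y).symm

noncomputable instance [CompleteSpace E] : CStarAlgebra (Adjointable A E) where

/-- Conjugation `T ↦ U* T U` by a unitary `U : E → F` of Hilbert modules with adjoint `V`. -/
noncomputable def conj {F : Type*} [NormedAddCommGroup F] [NormedSpace ℂ F] [SMul A F]
    [CStarModule A F] [CompleteSpace E] [CompleteSpace F] (U : E →L[ℂ] F) (V : F →L[ℂ] E)
    (h : ∀ x y, inner A (U x) y = inner A x (V y)) (hVU : ∀ x, V (U x) = x)
    (hUV : ∀ y, U (V y) = y) : Adjointable A F →⋆ₐ[ℂ] Adjointable A E :=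
  have h' : ∀ y x, inner A (V y) x = inner A y (U x) := fun y x => by
    rw [← CStarModule.star_inner, ← h, CStarModule.star_inner]
  { toFun := fun T => ⟨V ∘L T.1 ∘L U, V ∘L (star T).1 ∘L U, fun x y => by
      change inner A (V (T.1 (U x))) y = inner A x (V ((star T).1 (U y)))
      rw [h', inner_left, h]⟩
    map_one' := ext_apply hVU
    map_mul' := fun S T => ext_apply fun x => by
      change V (S.1 (T.1 (U x))) = V (S.1 (U (V (T.1 (U x)))))
      rw [hUV]
    map_zero' := ext_apply fun x => map_zero V
    map_add' := fun S T => ext_apply fun x => map_add V _ _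
    commutes' := fun c => ext_apply fun x => by
      change V (c • U x) = c • x
      rw [map_smul, hVU]
    map_star' := fun T => (star_eq_of_inner fun x y => by
      change inner A (V (T.1 (U x))) y = inner A x (V ((star T).1 (U y)))
      rw [h', inner_left, h]).symm }

end Adjointable

end Adjointable

/-! ## The Hilbert module of a positive definite kernel -/

section MatrixPositivity

variable {A : Type*} [CStarAlgebra A] [PartialOrder A] [StarOrderedRing A]

theorem CStarMatrix.sum_nonneg_of_nonneg {n : ℕ} {M : CStarMatrix (Fin n) (Fin n) A} (hM : 0 ≤ M)
    (c : Fin n → ℂ) : 0 ≤ ∑ i, ∑ j, (star (c i) * c j) • M i j := by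
  rw [StarOrderedRing.nonneg_iff] at hM
  induction hM using AddSubmonoid.closure_induction with
  | zero => simp
  | add M N _ _ hM hN => simpa [Finset.sum_add_distrib] using add_nonneg hM hN
  | mem M h =>
    obtain ⟨N, rfl⟩ := h
    have h : ∑ i, ∑ j, (star (c i) * c j) • (star N * N) i j
        = ∑ r, star (∑ i, c i • N r i) * ∑ j, c j • N r j := by
      simp only [CStarMatrix.mul_apply, CStarMatrix.star_apply, Finset.smul_sum, star_sum,
        star_smul, Finset.sum_mul_sum, smul_mul_smul_comm]
      rw [Finset.sum_comm_cycle]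
    exact h ▸ Finset.sum_nonneg fun r _ => star_mul_self_nonneg _

theorem CStarMatrix.diag_conj_nonneg {n : ℕ} {M : CStarMatrix (Fin n) (Fin n) A} (hM : 0 ≤ M)
    (x : Fin n → A) :
    0 ≤ (CStarMatrix.ofMatrix (Matrix.of fun i j => star (x i) * M i j * x j) :
      CStarMatrix (Fin n) (Fin n) A) := by
  let D : CStarMatrix (Fin n) (Fin n) A := CStarMatrix.ofMatrix (Matrix.diagonal x)
  have h := star_left_conjugate_nonneg hM D
  convert h using 1
  ext i j
  simp [D, CStarMatrix.mul_apply, CStarMatrix.star_apply, Matrix.diagonal_apply, apply_ite star, eq_comm]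

theorem CStarMatrix.ones_nonneg (n : ℕ) :
    0 ≤ (CStarMatrix.ofMatrix (Matrix.of fun _ _ => 1) : CStarMatrix (Fin n) (Fin n) A) := by
  cases n with
  | zero => exact (CStarMatrix.ext fun i => i.elim0 : (0 : CStarMatrix (Fin 0) (Fin 0) A) = _).le
  | succ n =>
    let M : CStarMatrix (Fin (n + 1)) (Fin (n + 1)) A :=
      CStarMatrix.ofMatrix (Matrix.of fun i _ => if i = 0 then 1 else 0)
    convert star_mul_self_nonneg M using 1
    ext i j
    simp [M, CStarMatrix.mul_apply, CStarMatrix.star_apply, apply_ite star]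

end MatrixPositivity

/-- An `A`-valued positive definite kernel on a set `T` with a compatible right action of `A`. -/
structure ModuleKernel (A T : Type*) [CStarAlgebra A] [PartialOrder A] [StarOrderedRing A] where
  toFun : T → T → A
  act : T → A → T
  act_right : ∀ s t a, toFun s (act t a) = toFun s t * a
  pos : ∀ (n : ℕ) (t : Fin n → T),
    0 ≤ (CStarMatrix.ofMatrix (Matrix.of fun i j => toFun (t i) (t j)) : CStarMatrix (Fin n) (Fin n) A)

namespace ModuleKernel

open MulOpposite

variable {A T : Type*} [CStarAlgebra A] [PartialOrder A] [StarOrderedRing A]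
  (κ : ModuleKernel A T)

theorem star_toFun (s t : T) : star (κ.toFun s t) = κ.toFun t s := by
  have h := IsSelfAdjoint.of_nonneg (κ.pos 2 ![s, t])
  have h' := congrArg (fun M : CStarMatrix (Fin 2) (Fin 2) A => M 1 0) h.star_eq
  simpa [CStarMatrix.star_apply] using h'

/-- Formal finite linear combinations of elements of `T`. -/
def Pre (_ : ModuleKernel A T) : Type _ := T →₀ ℂ

noncomputable instance : AddCommGroup κ.Pre := inferInstanceAs (AddCommGroup (T →₀ ℂ))
noncomputable instance : Module ℂ κ.Pre := inferInstanceAs (Module ℂ (T →₀ ℂ))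

/-- The generator given by an element of `T`. -/
noncomputable def gen (t : T) : κ.Pre := Finsupp.single t (1 : ℂ)

/-- The linear extension of a map on generators. -/
noncomputable def extend {M : Type*} [AddCommGroup M] [Module ℂ M] (f : T → M) : κ.Pre →ₗ[ℂ] M :=
  (Finsupp.lift M ℂ T f : (T →₀ ℂ) →ₗ[ℂ] M)

theorem extend_gen {M : Type*} [AddCommGroup M] [Module ℂ M] (f : T → M) (t : T) :
    κ.extend f (κ.gen t) = f t := by
  exact (Finsupp.sum_single_index (h := fun t c => c • f t) (zero_smul ℂ (f t))).trans
    (one_smul ℂ (f t))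

theorem Pre.induction {Q : κ.Pre → Prop} (h0 : Q 0) (hadd : ∀ x y, Q x → Q y → Q (x + y))
    (hgen : ∀ (c : ℂ) (t : T), Q (c • κ.gen t)) (x : κ.Pre) : Q x := by
  refine Finsupp.induction_linear (motive := Q) x h0 hadd fun t c => ?_
  have := hgen c t
  rwa [show c • κ.gen t = (Finsupp.single t c : T →₀ ℂ) by
    exact (Finsupp.smul_single c t (1 : ℂ)).trans (by rw [smul_eq_mul, mul_one])] at this

theorem hom_ext {M : Type*} [AddCommGroup M] [Module ℂ M] {f g : κ.Pre →ₗ[ℂ] M}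
    (h : ∀ t, f (κ.gen t) = g (κ.gen t)) : f = g :=
  LinearMap.ext <| Pre.induction κ (by rw [map_zero, map_zero])
    (fun x y hx hy => by rw [map_add, map_add, hx, hy])
    fun c t => by rw [map_smul, map_smul, h]

/-- The `A`-valued inner product, conjugate linear in the first variable, with
`⟨s, t⟩ = κ s t` on generators. -/
noncomputable def ip : κ.Pre →ₗ⋆[ℂ] κ.Pre →ₗ[ℂ] A where
  toFun x := κ.extend fun t => Finsupp.sum (x : T →₀ ℂ) fun s c => star c • κ.toFun s t
  map_add' x y := κ.hom_ext fun t => by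
    rw [LinearMap.add_apply, extend_gen, extend_gen, extend_gen]
    exact Finsupp.sum_add_index' (f := (x : T →₀ ℂ)) (g := (y : T →₀ ℂ)) (by simp)
      (by simp [add_smul])
  map_smul' c x := κ.hom_ext fun t => by
    rw [LinearMap.smul_apply, extend_gen, extend_gen]
    refine (Finsupp.sum_smul_index (g := (x : T →₀ ℂ)) (by simp)).trans ?_
    simp only [mul_smul, star_mul']
    exact (Finsupp.smul_sum (v := (x : T →₀ ℂ))).symm

theorem ip_gen (s t : T) : κ.ip (κ.gen s) (κ.gen t) = κ.toFun s t := by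
  change κ.extend _ (κ.gen t) = _
  rw [extend_gen]
  exact (Finsupp.sum_single_index (by simp)).trans (by simp)

theorem star_ip (x y : κ.Pre) : star (κ.ip x y) = κ.ip y x := by
  refine Pre.induction κ (Q := fun x => star (κ.ip x y) = κ.ip y x) (by simp)
    (fun x x' hx hx' => by simp [hx, hx']) (fun c s => ?_) x
  refine Pre.induction κ (Q := fun y => star (κ.ip (c • κ.gen s) y) = κ.ip y (c • κ.gen s))
    (by simp) (fun x x' hx hx' => by rw [map_add, star_add, hx, hx', map_add, LinearMap.add_apply])
    (fun d t => ?_) y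
  simp [ip_gen, star_toFun, smul_smul, mul_comm]

theorem ip_self_nonneg (x : κ.Pre) : 0 ≤ κ.ip x x := by
  let x' : T →₀ ℂ := x
  let e := x'.support.equivFin.symm
  have h := CStarMatrix.sum_nonneg_of_nonneg (κ.pos _ fun i => (e i : T)) (fun i => x' (e i))
  have hx : x = ∑ i, x' (e i) • κ.gen (e i : T) := by
    have h1 : ∑ i, x' (e i) • κ.gen (e i : T) = ∑ s : x'.support, x' s • κ.gen (s : T) :=
      e.sum_comp fun s : x'.support => x' s • κ.gen (s : T)
    rw [h1, Finset.sum_coe_sort x'.support fun s => x' s • κ.gen s]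
    conv_lhs => rw [show x = x' from rfl, ← Finsupp.sum_single x']
    refine Finset.sum_congr rfl fun s _ => ?_
    exact (by rw [smul_eq_mul, mul_one] : Finsupp.single s (x' s) = Finsupp.single s (x' s • (1:ℂ))).trans
      (Finsupp.smul_single (x' s) s (1 : ℂ)).symm
  have h2 : κ.ip x x = ∑ i, ∑ j, (star (x' (e i)) * x' (e j)) •
      (CStarMatrix.ofMatrix (Matrix.of fun i j => κ.toFun (e i) (e j)) :
        CStarMatrix (Fin _) (Fin _) A) i j := by
    conv_lhs => rw [hx]
    simp only [map_sum, LinearMap.sum_apply, map_smulₛₗ, LinearMap.smul_apply, ip_gen]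
    rw [Finset.sum_comm]
    simp [Finset.smul_sum, smul_smul, mul_comm]
  rw [h2]
  exact h

/-- The right action of `a : A` on formal linear combinations. -/
noncomputable def ract (a : A) : κ.Pre →ₗ[ℂ] κ.Pre := κ.extend fun t => κ.gen (κ.act t a)

theorem ip_ract (a : A) (x y : κ.Pre) : κ.ip x (κ.ract a y) = κ.ip x y * a := by
  have key : ∀ s : T, (κ.ip (κ.gen s)) ∘ₗ κ.ract a
      = (LinearMap.mulRight ℂ a) ∘ₗ κ.ip (κ.gen s) := fun s => κ.hom_ext fun t => by
    simp [ract, extend_gen, ip_gen, κ.act_right]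
  refine Pre.induction κ (Q := fun x => κ.ip x (κ.ract a y) = κ.ip x y * a) (by simp)
    (fun x x' hx hx' => by simp [hx, hx', add_mul]) (fun c s => ?_) x
  have := LinearMap.congr_fun (key s) y
  simp only [LinearMap.comp_apply, LinearMap.mulRight_apply] at this
  simp [this]

theorem ip_ract_left (a : A) (x y : κ.Pre) : κ.ip (κ.ract a x) y = star a * κ.ip x y := by
  rw [← star_ip, ip_ract, star_mul, star_ip]

theorem cauchy_schwarz (x y : κ.Pre) : ‖κ.ip x y‖ ≤ √‖κ.ip x x‖ * √‖κ.ip y y‖ := by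
  have key : ∀ r : ℝ, ‖κ.ip x x‖ < r → ‖κ.ip x y‖ ^ 2 ≤ r * ‖κ.ip y y‖ := fun r hr => by
    have hr0 : 0 < r := (norm_nonneg _).trans_lt hr
    set a := κ.ip x y with ha
    have h1 := κ.ip_self_nonneg (κ.ract a x - (r : ℂ) • y)
    have h2 : κ.ip (κ.ract a x - (r : ℂ) • y) (κ.ract a x - (r : ℂ) • y)
        = star a * κ.ip x x * a - (2 * r) • (star a * a) + (r * r) • κ.ip y y := by
      have e1 : κ.ip y x = star a := by rw [ha, star_ip]
      simp only [map_sub, LinearMap.sub_apply, map_smulₛₗ, LinearMap.smul_apply, ip_ract,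
        ip_ract_left, e1, ← ha, RingHom.id_apply, Complex.conj_ofReal, smul_sub]
      simp only [Complex.coe_smul, two_mul, add_smul, mul_smul]
      abel
    rw [h2] at h1
    have h3 : star a * κ.ip x x * a ≤ r • (star a * a) :=
      (CStarAlgebra.star_left_conjugate_le_norm_smul
        (hb := IsSelfAdjoint.of_nonneg (κ.ip_self_nonneg x))).trans
        (smul_le_smul_of_nonneg_right hr.le (star_mul_self_nonneg a))
    have h4 : r • (star a * a) ≤ (r * r) • κ.ip y y := by
      rw [← sub_nonneg]
      refine h1.trans ?_
      have : star a * κ.ip x x * a - (2 * r) • (star a * a) + (r * r) • κ.ip y y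
        ≤ r • (star a * a) - (2 * r) • (star a * a) + (r * r) • κ.ip y y := by gcongr
      refine this.trans (le_of_eq ?_)
      rw [two_mul, add_smul]; abel
    have h5 := CStarAlgebra.norm_le_norm_of_nonneg_of_le
      (smul_nonneg hr0.le (star_mul_self_nonneg a)) h4
    rw [norm_smul, norm_smul, CStarRing.norm_star_mul_self, Real.norm_of_nonneg hr0.le,
      Real.norm_of_nonneg (by positivity)] at h5
    nlinarith
  have h : ‖κ.ip x y‖ ^ 2 ≤ ‖κ.ip x x‖ * ‖κ.ip y y‖ := by
    rcases (norm_nonneg (κ.ip y y)).eq_or_lt with h0 | h0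
    · have := key (‖κ.ip x x‖ + 1) (by linarith)
      rw [← h0] at this ⊢
      linarith
    · rw [← div_le_iff₀ h0]
      refine le_of_forall_gt_imp_ge_of_dense fun r hr => ?_
      rw [div_le_iff₀ h0]
      exact key r hr
  rw [← Real.sqrt_mul (norm_nonneg _)]
  exact Real.le_sqrt_of_sq_le h

/-- The seminorm `x ↦ ‖⟨x, x⟩‖ ^ (1/2)`. -/
noncomputable def preSeminorm : AddGroupSeminorm κ.Pre where
  toFun x := √‖κ.ip x x‖
  map_zero' := by simp
  add_le' x y := by
    refine Real.sqrt_le_iff.2 ⟨by positivity, ?_⟩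
    have hx := Real.sq_sqrt (norm_nonneg (κ.ip x x))
    have hy := Real.sq_sqrt (norm_nonneg (κ.ip y y))
    have h1 := κ.cauchy_schwarz x y
    have h2 := κ.cauchy_schwarz y x
    have h3 : κ.ip (x + y) (x + y) = κ.ip x x + κ.ip x y + (κ.ip y x + κ.ip y y) := by
      simp only [map_add, LinearMap.add_apply]; abel
    rw [h3]
    have h4 := norm_add_le (κ.ip x x + κ.ip x y) (κ.ip y x + κ.ip y y)
    have h5 := norm_add_le (κ.ip x x) (κ.ip x y)
    have h6 := norm_add_le (κ.ip y x) (κ.ip y y)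
    nlinarith
  neg' x := by simp

noncomputable instance : SeminormedAddCommGroup κ.Pre :=
  κ.preSeminorm.toSeminormedAddCommGroup

theorem pre_norm_def (x : κ.Pre) : ‖x‖ = √‖κ.ip x x‖ := rfl

theorem pre_norm_sq (x : κ.Pre) : ‖x‖ ^ 2 = ‖κ.ip x x‖ := Real.sq_sqrt (norm_nonneg _)

noncomputable instance : NormedSpace ℂ κ.Pre where
  norm_smul_le c x := by
    rw [pre_norm_def, pre_norm_def, LinearMap.map_smulₛₗ κ.ip, LinearMap.smul_apply, map_smul,
      norm_smul,
      norm_smul, ← mul_assoc, RCLike.norm_conj, Real.sqrt_mul (by positivity),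
      Real.sqrt_mul_self (norm_nonneg c)]

/-- The right action of `a : A` as a bounded operator. -/
noncomputable def ractL (a : A) : κ.Pre →L[ℂ] κ.Pre :=
  (κ.ract a).mkContinuous ‖a‖ fun x => by
    rw [pre_norm_def, pre_norm_def, ip_ract, ip_ract_left]
    refine Real.sqrt_le_iff.2 ⟨by positivity, ?_⟩
    rw [mul_pow, Real.sq_sqrt (norm_nonneg _)]
    calc _ ≤ ‖star a‖ * ‖κ.ip x x‖ * ‖a‖ := norm_mul₃_le
      _ = _ := by rw [norm_star]; ring

/-- The right Hilbert `A`-module of the kernel, generated by `T` with inner products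
`⟨s, t⟩ = κ s t`: the separation and completion of the formal linear combinations. -/
def Module' : Type _ := UniformSpace.Completion κ.Pre

noncomputable instance : NormedAddCommGroup κ.Module' :=
  inferInstanceAs (NormedAddCommGroup (UniformSpace.Completion κ.Pre))

noncomputable instance : NormedSpace ℂ κ.Module' :=
  inferInstanceAs (NormedSpace ℂ (UniformSpace.Completion κ.Pre))

instance : CompleteSpace κ.Module' :=
  inferInstanceAs (CompleteSpace (UniformSpace.Completion κ.Pre))

/-- The canonical map of the formal linear combinations to the Hilbert module. -/
noncomputable def toModule : κ.Pre →L[ℂ] κ.Module' :=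
  (UniformSpace.Completion.toComplL : κ.Pre →L[ℂ] UniformSpace.Completion κ.Pre)

theorem norm_toModule (x : κ.Pre) : ‖κ.toModule x‖ = ‖x‖ :=
  UniformSpace.Completion.norm_coe x

/-- The `A`-valued inner product of the Hilbert module. -/
noncomputable def hip (x y : κ.Module') : A :=
  ((UniformSpace.Completion.isDenseInducing_toCompl κ.Pre).prodMap
    (UniformSpace.Completion.isDenseInducing_toCompl κ.Pre)).extend
      (fun p : κ.Pre × κ.Pre => κ.ip p.1 p.2) (x, y)

theorem continuous_ip : Continuous fun p : κ.Pre × κ.Pre => κ.ip p.1 p.2 := by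
  let f := LinearMap.mkContinuous₂ κ.ip 1 fun x y => by
    rw [one_mul]; exact κ.cauchy_schwarz x y
  exact (f.continuous.comp continuous_fst).clm_apply continuous_snd

theorem hip_coe (x y : κ.Pre) : κ.hip (κ.toModule x) (κ.toModule y) = κ.ip x y :=
  ((UniformSpace.Completion.isDenseInducing_toCompl κ.Pre).prodMap
    (UniformSpace.Completion.isDenseInducing_toCompl κ.Pre)).extend_eq κ.continuous_ip (x, y)

theorem continuous_hip : Continuous fun p : κ.Module' × κ.Module' => κ.hip p.1 p.2 := by
  let m : κ.Pre →+ κ.Pre →+ A :=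
    { toFun := fun x => (κ.ip x).toAddMonoidHom
      map_zero' := by ext x; simp
      map_add' := fun x y => by ext z; simp }
  have h : Continuous fun p : κ.Pre × κ.Pre => m p.1 p.2 := κ.continuous_ip
  have h2 := (UniformSpace.Completion.isDenseInducing_toCompl κ.Pre).extend_Z_bilin
    (UniformSpace.Completion.isDenseInducing_toCompl κ.Pre) h
  exact h2

theorem _root_.Continuous.hip {X : Type*} [TopologicalSpace X] {f g : X → κ.Module'}
    (hf : Continuous f) (hg : Continuous g) : Continuous fun x => κ.hip (f x) (g x) :=
  κ.continuous_hip.comp (hf.prodMk hg)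

theorem induction {Q : κ.Module' → Prop} (hQ : IsClosed {x | Q x}) (h : ∀ x, Q (κ.toModule x))
    (x : κ.Module') : Q x :=
  UniformSpace.Completion.induction_on (α := κ.Pre) x hQ h

theorem induction₂ {Q : κ.Module' → κ.Module' → Prop}
    (hQ : IsClosed {x : κ.Module' × κ.Module' | Q x.1 x.2})
    (h : ∀ x y, Q (κ.toModule x) (κ.toModule y)) (x y : κ.Module') : Q x y :=
  UniformSpace.Completion.induction_on₂ (α := κ.Pre) (β := κ.Pre) x y hQ h

/-- A bounded operator between formal linear combinations induces one of the Hilbert modules. -/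
noncomputable def mapL {κ : ModuleKernel A T} {T' : Type*} {κ' : ModuleKernel A T'}
    (f : κ.Pre →L[ℂ] κ'.Pre) : κ.Module' →L[ℂ] κ'.Module' :=
  (f.completion : UniformSpace.Completion κ.Pre →L[ℂ] UniformSpace.Completion κ'.Pre)

theorem mapL_coe {κ : ModuleKernel A T} {T' : Type*} {κ' : ModuleKernel A T'}
    (f : κ.Pre →L[ℂ] κ'.Pre) (x : κ.Pre) : mapL f (κ.toModule x) = κ'.toModule (f x) :=
  f.completion_apply_coe x

noncomputable instance : SMul Aᵐᵒᵖ κ.Module' := ⟨fun a x => mapL (κ.ractL a.unop) x⟩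

theorem smul_def (a : Aᵐᵒᵖ) (x : κ.Module') : a • x = mapL (κ.ractL a.unop) x := rfl

theorem norm_eq_sqrt_hip (x : κ.Module') : ‖x‖ = √‖κ.hip x x‖ :=
  κ.induction (Q := fun x => ‖x‖ = √‖κ.hip x x‖)
    (isClosed_eq continuous_norm (Continuous.hip κ continuous_id continuous_id).norm.sqrt)
    (fun x => by rw [hip_coe, norm_toModule, pre_norm_def]) x

theorem hip_self_nonneg (x : κ.Module') : 0 ≤ κ.hip x x :=
  κ.induction (Q := fun x => 0 ≤ κ.hip x x)
    (CStarAlgebra.isClosed_nonneg.preimage (.hip κ continuous_id continuous_id))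
    (fun x => by rw [hip_coe]; exact κ.ip_self_nonneg x) x

theorem star_hip (x y : κ.Module') : star (κ.hip x y) = κ.hip y x :=
  κ.induction₂ (Q := fun x y => star (κ.hip x y) = κ.hip y x)
    (isClosed_eq (Continuous.hip κ continuous_fst continuous_snd).star
      (.hip κ continuous_snd continuous_fst))
    (fun x y => by rw [hip_coe, hip_coe, star_ip]) x y

theorem hip_add (x y z : κ.Module') : κ.hip x (y + z) = κ.hip x y + κ.hip x z := by
  refine κ.induction (Q := fun x => κ.hip x (y + z) = κ.hip x y + κ.hip x z)
    (isClosed_eq (.hip κ continuous_id continuous_const)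
      ((Continuous.hip κ continuous_id continuous_const).add
        (.hip κ continuous_id continuous_const))) (fun x => ?_) x
  refine κ.induction₂ (Q := fun y z => κ.hip (κ.toModule x) (y + z)
    = κ.hip (κ.toModule x) y + κ.hip (κ.toModule x) z)
    (isClosed_eq (.hip κ continuous_const (continuous_fst.add continuous_snd))
      ((Continuous.hip κ continuous_const continuous_fst).add
        (.hip κ continuous_const continuous_snd))) (fun y z => ?_) y z
  rw [← map_add, hip_coe, hip_coe, hip_coe, map_add]

theorem hip_smul (c : ℂ) (x y : κ.Module') : κ.hip x (c • y) = c • κ.hip x y :=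
  κ.induction₂ (Q := fun x y => κ.hip x (c • y) = c • κ.hip x y)
    (isClosed_eq (.hip κ continuous_fst (continuous_snd.const_smul c))
      ((Continuous.hip κ continuous_fst continuous_snd).const_smul c))
    (fun x y => by rw [← map_smul, hip_coe, hip_coe, map_smul]) x y

theorem hip_ract (a : A) (x y : κ.Module') : κ.hip x (mapL (κ.ractL a) y) = κ.hip x y * a :=
  κ.induction₂ (Q := fun x y => κ.hip x (mapL (κ.ractL a) y) = κ.hip x y * a)
    (isClosed_eq (.hip κ continuous_fst ((mapL (κ.ractL a)).continuous.comp continuous_snd))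
      ((Continuous.hip κ continuous_fst continuous_snd).mul continuous_const))
    (fun x y => by rw [mapL_coe, hip_coe, hip_coe]; exact κ.ip_ract _ x y) x y

noncomputable instance : CStarModule Aᵐᵒᵖ κ.Module' where
  inner x y := op (κ.hip x y)
  inner_add_right := congrArg op (κ.hip_add _ _ _)
  inner_self_nonneg := κ.hip_self_nonneg _
  inner_self {x} := by
    rw [op_eq_zero_iff, ← norm_eq_zero, ← norm_eq_zero (a := x), κ.norm_eq_sqrt_hip,
      Real.sqrt_eq_zero (norm_nonneg _)]
  inner_op_smul_right {a x y} := congrArg op (κ.hip_ract a.unop x y)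
  inner_smul_right_complex {c x y} := congrArg op (κ.hip_smul c x y)
  star_inner x y := congrArg op (κ.star_hip x y)
  norm_eq_sqrt_norm_inner_self := κ.norm_eq_sqrt_hip

theorem inner_def (x y : κ.Module') : inner Aᵐᵒᵖ x y = op (κ.hip x y) := rfl

theorem inner_coe (x y : κ.Pre) :
    inner Aᵐᵒᵖ (κ.toModule x) (κ.toModule y) = op (κ.ip x y) := by
  rw [inner_def, hip_coe]

/-- Adjointness of bounded operators can be checked on formal linear combinations. -/
theorem inner_mapL {κ : ModuleKernel A T} {T' : Type*} {κ' : ModuleKernel A T'}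
    {f : κ.Pre →L[ℂ] κ'.Pre} {g : κ'.Pre →L[ℂ] κ.Pre}
    (h : ∀ x y, κ'.ip (f x) y = κ.ip x (g y)) (x : κ.Module') (y : κ'.Module') :
    inner Aᵐᵒᵖ (mapL f x) y = inner Aᵐᵒᵖ x (mapL g y) := by
  refine congrArg op (?_ : κ'.hip (mapL f x) y = κ.hip x (mapL g y))
  refine κ.induction (Q := fun x => κ'.hip (mapL f x) y = κ.hip x (mapL g y))
    (isClosed_eq (.hip κ' (mapL f).continuous continuous_const)
      (.hip κ continuous_id continuous_const)) (fun x => ?_) x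
  refine κ'.induction (Q := fun y => κ'.hip (mapL f (κ.toModule x)) y
    = κ.hip (κ.toModule x) (mapL g y))
    (isClosed_eq (.hip κ' continuous_const continuous_id)
      (.hip κ continuous_const (mapL g).continuous)) (fun y => ?_) y
  rw [mapL_coe, mapL_coe, hip_coe, hip_coe, h]

end ModuleKernel

/-! ## Conditional expectations and the Hilbert modules of the vertex-reduced free product -/

/-- A conditional expectation of a unital C*-algebra `A` onto a unital C*-subalgebra `B`, the
inclusion being given by `j`: a completely positive `B`-bimodule map which is the identity
on `B`. -/
structure ConditionalExpectation {A B : Type*} [CStarAlgebra A] [PartialOrder A]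
    [StarOrderedRing A] [CStarAlgebra B] [PartialOrder B] [StarOrderedRing B]
    (j : B →⋆ₐ[ℂ] A) extends CompletelyPositiveMap A B where
  apply_incl' : ∀ b, toLinearMap (j b) = b
  apply_bimodule' : ∀ b a b', toLinearMap (j b * a * j b') = b * toLinearMap a * b'

namespace ConditionalExpectation

variable {A B : Type*} [CStarAlgebra A] [PartialOrder A]
    [StarOrderedRing A] [CStarAlgebra B] [PartialOrder B] [StarOrderedRing B]
    {j : B →⋆ₐ[ℂ] A}

noncomputable instance : CoeFun (ConditionalExpectation j) (fun _ => A → B) := ⟨fun E => E.toLinearMap⟩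

theorem apply_incl (E : ConditionalExpectation j) (b : B) : E (j b) = b := E.apply_incl' b

theorem apply_one (E : ConditionalExpectation j) : E 1 = 1 := by
  simpa using E.apply_incl 1

theorem apply_incl_mul (E : ConditionalExpectation j) (b : B) (a : A) :
    E (j b * a) = b * E a := by
  simpa using E.apply_bimodule' b a 1

theorem apply_mul_incl (E : ConditionalExpectation j) (b : B) (a : A) :
    E (a * j b) = E a * b := by
  simpa using E.apply_bimodule' 1 a b

theorem apply_star (E : ConditionalExpectation j) (a : A) : E (star a) = star (E a) :=
  map_star E.toCompletelyPositiveMap a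

theorem apply_sub_self (E : ConditionalExpectation j) (a : A) : E (a - j (E a)) = 0 := by
  rw [map_sub, E.apply_incl, sub_self]

end ConditionalExpectation

/-- Elementary tensors `a₁ ⊗ a₂ ⊗ ⋯ ⊗ aₙ`, `n ≥ 1`, with `aᵣ ∈ A iᵣ`, where `i₁ = k`, `iₙ = l` and
the indices `i₁, i₂, …` are alternately `k` and `m`. -/
inductive Word {ι : Type} (A : ι → Type*) (l : ι) : ι → ι → Type _
  | last {m : ι} (a : A l) : Word A l l m
  | cons {k m : ι} (a : A k) (t : Word A l m k) : Word A l k m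

namespace Word

variable {ι : Type} {A : ι → Type*} {B : Type*} [∀ k, CStarAlgebra (A k)]
  [∀ k, PartialOrder (A k)] [∀ k, StarOrderedRing (A k)]
  [CStarAlgebra B] [PartialOrder B] [StarOrderedRing B]
  {j : ∀ k, B →⋆ₐ[ℂ] A k} (E : ∀ k, ConditionalExpectation (j k)) {l : ι}

/-- Left multiplication of the first entry. -/
def lmul : {k m : ι} → A k → Word A l k m → Word A l k m
  | _, _, c, last a => last (c * a)
  | _, _, c, cons a t => cons (c * a) t

/-- Right multiplication of the last entry. -/
def rmul : {k m : ι} → Word A l k m → A l → Word A l k m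
  | _, _, last a, c => last (a * c)
  | _, _, cons a t, c => cons a (t.rmul c)

/-- All entries except the last one are in the kernels of the conditional expectations. -/
def Centered : {k m : ι} → Word A l k m → Prop
  | _, _, last _ => True
  | k, _, cons a t => E k a = 0 ∧ t.Centered

/-- All entries except the first and the last one are in the kernels of the conditional
expectations. -/
def Admissible : {k m : ι} → Word A l k m → Prop
  | _, _, last _ => True
  | _, _, cons _ t => t.Centered E

/-- The inner products of the elementary tensors of
`K_{i₁} ⊗_B K_{i₂} ⊗_B ⋯ ⊗_B K_{iₙ₋₁} ⊗_B A_{iₙ}`, where `K_k` is the GNS module of `E k`: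
`⟨a₁ ⊗ x, a₁' ⊗ x'⟩ = ⟨x, E (a₁* a₁') x'⟩`, and tensors of different types are orthogonal.
For `b : B`, `gram b x x'` is `⟨x, b x'⟩`. -/
noncomputable def gram : {k m : ι} → B → Word A l k m → Word A l k m → A l
  | _, _, b, last a, last a' => star a * j l b * a'
  | k, _, b, cons a t, cons a' t' => gram (E k (star a * j k b * a')) t t'
  | _, _, _, last _, cons _ _ => 0
  | _, _, _, cons _ _, last _ => 0

theorem gram_add (b b' : B) : ∀ {k m : ι} (w w' : Word A l k m),
    gram E (b + b') w w' = gram E b w w' + gram E b' w w'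
  | _, _, last _, last _ => by simp only [gram, map_add, mul_add, add_mul]
  | _, _, cons _ t, cons _ t' => by
    simp only [gram, map_add, mul_add, add_mul]
    exact gram_add _ _ t t'
  | _, _, last _, cons _ _ => by simp only [gram, add_zero]
  | _, _, cons _ _, last _ => by simp only [gram, add_zero]

theorem gram_smul (c : ℂ) (b : B) : ∀ {k m : ι} (w w' : Word A l k m),
    gram E (c • b) w w' = c • gram E b w w'
  | _, _, last _, last _ => by simp only [gram, map_smul, mul_smul_comm, smul_mul_assoc]
  | _, _, cons _ t, cons _ t' => by
    simp only [gram, map_smul, mul_smul_comm, smul_mul_assoc]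
    exact gram_smul c _ t t'
  | _, _, last _, cons _ _ => by simp only [gram, smul_zero]
  | _, _, cons _ _, last _ => by simp only [gram, smul_zero]

theorem gram_zero {k m : ι} (w w' : Word A l k m) : gram E 0 w w' = 0 := by
  have := gram_smul E 0 0 w w'
  rwa [zero_smul, zero_smul] at this

theorem gram_sub (b b' : B) {k m : ι} (w w' : Word A l k m) :
    gram E (b - b') w w' = gram E b w w' - gram E b' w w' := by
  have h := gram_add E b ((-1 : ℂ) • b') w w'
  rw [gram_smul, neg_one_smul, neg_one_smul, ← sub_eq_add_neg, ← sub_eq_add_neg] at h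
  exact h

theorem gram_rmul (c : A l) : ∀ {k m : ι} (b : B) (w w' : Word A l k m),
    gram E b w (w'.rmul c) = gram E b w w' * c
  | _, _, _, last _, last _ => by simp only [gram, rmul, mul_assoc]
  | _, _, _, cons _ t, cons _ t' => by
    simp only [gram, rmul]
    exact gram_rmul c _ t t'
  | _, _, _, last _, cons _ _ => by simp only [gram, rmul, zero_mul]
  | _, _, _, cons _ _, last _ => by simp only [gram, rmul, zero_mul]

theorem star_gram : ∀ {k m : ι} (b : B) (w w' : Word A l k m),
    star (gram E b w w') = gram E (star b) w' w
  | _, _, b, last _, last _ => by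
    simp only [gram, star_mul, star_star, map_star, mul_assoc]
  | _, _, b, cons _ t, cons _ t' => by
    simp only [gram]
    rw [star_gram, ← ConditionalExpectation.apply_star]
    simp only [star_mul, star_star, map_star, mul_assoc]
  | _, _, _, last _, cons _ _ => by simp only [gram, star_zero]
  | _, _, _, cons _ _, last _ => by simp only [gram, star_zero]

/-- `⟨x, β b y⟩ = ⟨x, β (b y)⟩`. -/
theorem gram_mul (β b : B) : ∀ {k m : ι} (w w' : Word A l k m),
    gram E (β * b) w w' = gram E β w (w'.lmul (j k b))
  | _, _, last _, last _ => by simp only [gram, lmul, map_mul, mul_assoc]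
  | _, _, cons _ _, cons _ _ => by simp only [gram, lmul, map_mul, mul_assoc]
  | _, _, last _, cons _ _ => by simp only [gram, lmul]
  | _, _, cons _ _, last _ => by simp only [gram, lmul]

theorem gram_eq_lmul (b : B) {k m : ι} (w w' : Word A l k m) :
    gram E b w w' = gram E 1 w (w'.lmul (j k b)) := by
  rw [← gram_mul, one_mul]

theorem gram_lmul : ∀ {k m : ι} (c : A k) (w w' : Word A l k m),
    gram E 1 (w.lmul c) w' = gram E 1 w (w'.lmul (star c))
  | _, _, _, last _, last _ => by simp only [gram, lmul, map_one, mul_one, star_mul, mul_assoc]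
  | _, _, _, cons _ _, cons _ _ => by
    simp only [gram, lmul, map_one, mul_one, star_mul, mul_assoc]
  | _, _, _, last _, cons _ _ => by simp only [gram, lmul]
  | _, _, _, cons _ _, last _ => by simp only [gram, lmul]

theorem gram_lmul_add : ∀ {k m : ι} (c c' : A k) (w w' : Word A l k m),
    gram E 1 w (w'.lmul (c + c')) = gram E 1 w (w'.lmul c) + gram E 1 w (w'.lmul c')
  | _, _, _, _, last _, last _ => by simp only [gram, lmul, add_mul, mul_add]
  | _, _, _, _, cons _ _, cons _ _ => by simp only [gram, lmul, add_mul, mul_add, map_add, gram_add]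
  | _, _, _, _, last _, cons _ _ => by simp only [gram, lmul, add_zero]
  | _, _, _, _, cons _ _, last _ => by simp only [gram, lmul, add_zero]

theorem gram_lmul_smul : ∀ {k m : ι} (z : ℂ) (c : A k) (w w' : Word A l k m),
    gram E 1 w (w'.lmul (z • c)) = z • gram E 1 w (w'.lmul c)
  | _, _, _, _, last _, last _ => by simp only [gram, lmul, smul_mul_assoc, mul_smul_comm]
  | _, _, _, _, cons _ _, cons _ _ => by
    simp only [gram, lmul, smul_mul_assoc, mul_smul_comm, map_smul, gram_smul]
  | _, _, _, _, last _, cons _ _ => by simp only [gram, lmul, smul_zero]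
  | _, _, _, _, cons _ _, last _ => by simp only [gram, lmul, smul_zero]

theorem lmul_mul : ∀ {k m : ι} (c c' : A k) (w : Word A l k m),
    w.lmul (c * c') = (w.lmul c').lmul c
  | _, _, _, _, last _ => by simp only [lmul, mul_assoc]
  | _, _, _, _, cons _ _ => by simp only [lmul, mul_assoc]

theorem lmul_one : ∀ {k m : ι} (w : Word A l k m), w.lmul 1 = w
  | _, _, last _ => by simp only [lmul, one_mul]
  | _, _, cons _ _ => by simp only [lmul, one_mul]

theorem Admissible.lmul {E : ∀ k, ConditionalExpectation (j k)} : ∀ {k m : ι} {w : Word A l k m},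
    w.Admissible E → ∀ c, (w.lmul c).Admissible E
  | _, _, last _, _, _ => trivial
  | _, _, cons _ _, h, _ => h

theorem Centered.rmul {E : ∀ k, ConditionalExpectation (j k)} : ∀ {k m : ι} {w : Word A l k m},
    w.Centered E → ∀ c, (w.rmul c).Centered E
  | _, _, last _, _, _ => trivial
  | _, _, cons _ _, h, c => ⟨h.1, h.2.rmul c⟩

theorem Admissible.rmul {E : ∀ k, ConditionalExpectation (j k)} : ∀ {k m : ι} {w : Word A l k m},
    w.Admissible E → ∀ c, (w.rmul c).Admissible E
  | _, _, last _, _, _ => trivial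
  | _, _, cons _ _, h, c => Centered.rmul h c

theorem Centered.admissible {E : ∀ k, ConditionalExpectation (j k)} :
    ∀ {k m : ι} {w : Word A l k m}, w.Centered E → w.Admissible E
  | _, _, last _, _ => trivial
  | _, _, cons _ _, h => h.2

section Positivity

/-- The entry of a word of length one, and `0` for longer words. -/
def lastVal : {k m : ι} → Word A l k m → A l
  | _, _, last a => a
  | _, _, cons _ _ => 0

/-- The first entry of a word of length at least two, and `0` for words of length one. -/
def headVal : {k m : ι} → Word A l k m → A k
  | _, _, last _ => 0
  | _, _, cons a _ => a

/-- The word without its first entry. -/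
def tailVal : {k m : ι} → Word A l k m → Word A l m k
  | _, _, last _ => cons 0 (last 0)
  | _, _, cons _ t => t

/-- The length of a word minus one. -/
def len : {k m : ι} → Word A l k m → ℕ
  | _, _, last _ => 0
  | _, _, cons _ t => t.len + 1

/-- The inner products computed up to a given length. -/
noncomputable def gramAux : ℕ → {k m : ι} → B → Word A l k m → Word A l k m → A l
  | 0, _, _, b, w, w' => star w.lastVal * j l b * w'.lastVal
  | n + 1, k, _, b, w, w' => star w.lastVal * j l b * w'.lastVal +
      gramAux n (E k (star w.headVal * j k b * w'.headVal)) w.tailVal w'.tailVal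

theorem gramAux_zero : ∀ (n : ℕ) {k m : ι} (w w' : Word A l k m), gramAux E n 0 w w' = 0
  | 0, _, _, w, w' => by simp only [gramAux, map_zero, mul_zero, zero_mul]
  | n + 1, _, _, w, w' => by
    simp only [gramAux, map_zero, mul_zero, zero_mul, zero_add]
    exact gramAux_zero n _ _

theorem gramAux_eq : ∀ (n : ℕ) {k m : ι} (b : B) (w w' : Word A l k m), w.len ≤ n →
    gramAux E n b w w' = gram E b w w'
  | 0, _, _, b, last a, last a', _ => by simp only [gramAux, gram, lastVal]
  | 0, _, _, b, last a, cons a' t', _ => by simp only [gramAux, gram, lastVal, mul_zero]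
  | 0, _, _, b, cons a t, _, h => by simp only [len] at h; omega
  | n + 1, _, _, b, last a, last a', _ => by
    simp only [gramAux, gram, lastVal, headVal, mul_zero, map_zero, gramAux_zero, add_zero]
  | n + 1, _, _, b, last a, cons a' t', _ => by
    simp only [gramAux, gram, lastVal, headVal, star_zero, zero_mul, mul_zero, map_zero,
      gramAux_zero, add_zero]
  | n + 1, _, _, b, cons a t, last a', _ => by
    simp only [gramAux, gram, lastVal, headVal, star_zero, zero_mul, mul_zero, map_zero,
      gramAux_zero, add_zero]
  | n + 1, _, _, b, cons a t, cons a' t', h => by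
    simp only [gramAux, gram, lastVal, headVal, tailVal, star_zero, zero_mul, zero_add]
    exact gramAux_eq n _ t t' (by simpa only [len, add_le_add_iff_right] using h)

theorem gramAux_nonneg : ∀ (N : ℕ) {k m : ι} (n : ℕ) (t : Fin n → Word A l k m)
    (b : CStarMatrix (Fin n) (Fin n) B), 0 ≤ b →
    0 ≤ (CStarMatrix.ofMatrix (Matrix.of fun i i' => gramAux E N (b i i') (t i) (t i')) :
      CStarMatrix (Fin n) (Fin n) (A l))
  | 0, _, _, n, t, b, hb => by
    have h1 : 0 ≤ b.map (j l) :=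
      CompletelyPositiveMapClass.map_cstarMatrix_nonneg' (j l) n b hb
    exact CStarMatrix.diag_conj_nonneg h1 fun i => (t i).lastVal
  | N + 1, k, _, n, t, b, hb => by
    have h1 : 0 ≤ b.map (j l) :=
      CompletelyPositiveMapClass.map_cstarMatrix_nonneg' (j l) n b hb
    have h2 : 0 ≤ b.map (j k) :=
      CompletelyPositiveMapClass.map_cstarMatrix_nonneg' (j k) n b hb
    have h3 := (E k).map_cstarMatrix_nonneg' n _
      (CStarMatrix.diag_conj_nonneg h2 fun i => (t i).headVal)
    exact add_nonneg (CStarMatrix.diag_conj_nonneg h1 fun i => (t i).lastVal)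
      (gramAux_nonneg N n (fun i => (t i).tailVal) _ h3)

theorem gram_nonneg {k m : ι} (n : ℕ) (t : Fin n → Word A l k m) :
    0 ≤ (CStarMatrix.ofMatrix (Matrix.of fun i i' => gram E 1 (t i) (t i')) :
      CStarMatrix (Fin n) (Fin n) (A l)) := by
  have h := gramAux_nonneg E (∑ i, (t i).len) n t _ (CStarMatrix.ones_nonneg n)
  convert h using 4
  funext i'
  exact (gramAux_eq E _ _ _ _ (Finset.single_le_sum (f := fun i => (t i).len)
    (fun _ _ => Nat.zero_le _) (Finset.mem_univ _))).symm

end Positivity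

end Word

namespace ModuleKernel

variable {A T T' : Type*} [CStarAlgebra A] [PartialOrder A] [StarOrderedRing A]
  {κ : ModuleKernel A T} {κ' : ModuleKernel A T'}

/-- Adjointness of linear maps can be checked on generators. -/
theorem ip_adj {f : κ.Pre →ₗ[ℂ] κ'.Pre} {g : κ'.Pre →ₗ[ℂ] κ.Pre}
    (h : ∀ s t, κ'.ip (f (κ.gen s)) (κ'.gen t) = κ.ip (κ.gen s) (g (κ'.gen t))) (x : κ.Pre)
    (y : κ'.Pre) : κ'.ip (f x) y = κ.ip x (g y) := by
  refine Pre.induction κ (Q := fun x => κ'.ip (f x) y = κ.ip x (g y)) (by simp)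
    (fun x x' hx hx' => by simp [hx, hx']) (fun c s => ?_) x
  refine Pre.induction κ' (Q := fun y => κ'.ip (f (c • κ.gen s)) y = κ.ip (c • κ.gen s) (g y))
    (by simp) (fun x x' hx hx' => by rw [map_add, hx, hx', map_add, map_add]) (fun d t => ?_) y
  simp [h]

/-- Equality of two linear maps up to vectors of length zero can be checked on generators. -/
theorem ip_congr {f g : κ.Pre →ₗ[ℂ] κ'.Pre}
    (h : ∀ s t, κ'.ip (κ'.gen s) (f (κ.gen t)) = κ'.ip (κ'.gen s) (g (κ.gen t))) (y : κ'.Pre)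
    (x : κ.Pre) : κ'.ip y (f x) = κ'.ip y (g x) := by
  refine Pre.induction κ' (Q := fun y => κ'.ip y (f x) = κ'.ip y (g x)) (by simp)
    (fun x x' hx hx' => by simp [hx, hx']) (fun c s => ?_) y
  refine Pre.induction κ (Q := fun x => κ'.ip (c • κ'.gen s) (f x) = κ'.ip (c • κ'.gen s) (g x))
    (by simp) (fun x x' hx hx' => by rw [map_add, map_add, hx, hx', map_add, map_add])
    (fun d t => ?_) x
  simp [h]

theorem toModule_eq {x y : κ.Pre} (h : ∀ z, κ.ip z x = κ.ip z y) :
    κ.toModule x = κ.toModule y := by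
  rw [← sub_eq_zero, ← map_sub, ← norm_eq_zero, norm_toModule, pre_norm_def, map_sub, h, sub_self,
    norm_zero, Real.sqrt_zero]

theorem mapL_ext {f g : κ.Module' →L[ℂ] κ'.Module'}
    (h : ∀ x, f (κ.toModule x) = g (κ.toModule x)) (x : κ.Module') : f x = g x :=
  κ.induction (isClosed_eq f.continuous g.continuous) h x

end ModuleKernel

namespace Word

variable {ι : Type} {A : ι → Type*} {B : Type*} [∀ k, CStarAlgebra (A k)]
  [∀ k, PartialOrder (A k)] [∀ k, StarOrderedRing (A k)]
  [CStarAlgebra B] [PartialOrder B] [StarOrderedRing B]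
  {j : ∀ k, B →⋆ₐ[ℂ] A k} {E : ∀ k, ConditionalExpectation (j k)} {k m l : ι}

theorem admissible_cons_last (a : A k) (c : A l) : (cons a (last c) : Word A l k l).Admissible E :=
  trivial

theorem admissible_cons_cons (a : A k) {c : A m} (h : E m c = 0) {t : Word A l k m}
    (ht : t.Centered E) : (cons a (cons c t)).Admissible E :=
  ⟨h, ht⟩

theorem Admissible.tail {a : A k} {t : Word A l m k} (h : (cons a t).Admissible E) :
    t.Centered E :=
  h

theorem Centered.head {a : A k} {t : Word A l m k} (h : (cons a t).Centered E) : E k a = 0 :=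
  h.1

theorem Centered.admissible_lmul {t : Word A l k m} (h : t.Centered E) (c : A k) :
    (t.lmul c).Admissible E :=
  Admissible.lmul (Centered.admissible h) c

end Word

namespace VertexModule

open Word MulOpposite ModuleKernel

variable {ι : Type} {A : ι → Type*} {B : Type*} [∀ k, CStarAlgebra (A k)]
  [∀ k, PartialOrder (A k)] [∀ k, StarOrderedRing (A k)]
  [CStarAlgebra B] [PartialOrder B] [StarOrderedRing B]
  {j : ∀ k, B →⋆ₐ[ℂ] A k} (E : ∀ k, ConditionalExpectation (j k)) (k m l : ι)

/-- The elementary tensors that span the Hilbert module `H E k m l`. -/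
structure Elem where
  /-- The elementary tensor. -/
  word : Word A l k m
  admissible : word.Admissible E

/-- The inner products of the elementary tensors, and the right action of `A l` on them. -/
noncomputable def kernel : ModuleKernel (A l) (Elem E k m l) where
  toFun w w' := gram E 1 w.word w'.word
  act w c := ⟨w.word.rmul c, w.admissible.rmul c⟩
  act_right w w' c := gram_rmul E c 1 w.word w'.word
  pos n t := gram_nonneg E n fun i => (t i).word

/-- The Hilbert `A l`-module which is the direct sum of the modules
`K_{i₁} ⊗_B K°_{i₂} ⊗_B ⋯ ⊗_B K°_{iₙ₋₁} ⊗_B A_{iₙ}` over all the words `i₁ i₂ ⋯ iₙ`, `n ≥ 1`, which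
are alternately `k` and `m` with `i₁ = k` and `iₙ = l`. Here `K_i` is the GNS module of `E i`, and
`K°_i` is the closed submodule generated by the kernel of `E i`. -/
abbrev H : Type _ := (kernel E k m l).Module'

variable {E k m l}

/-- The formal vector of an elementary tensor. -/
noncomputable def vec (w : Word A l k m) (h : w.Admissible E) : (kernel E k m l).Pre :=
  (kernel E k m l).gen ⟨w, h⟩

theorem ip_vec (w w' : Word A l k m) (h : w.Admissible E) (h' : w'.Admissible E) :
    (kernel E k m l).ip (vec w h) (vec w' h') = gram E 1 w w' :=
  (kernel E k m l).ip_gen _ _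

/-! ### The left action -/

/-- The left action of `c : A k`, on formal linear combinations of elementary tensors. -/
noncomputable def lamPre (c : A k) : (kernel E k m l).Pre →ₗ[ℂ] (kernel E k m l).Pre :=
  (kernel E k m l).extend fun w => vec (w.word.lmul c) (w.admissible.lmul c)

theorem lamPre_gen (c : A k) (w : Elem E k m l) :
    lamPre c ((kernel E k m l).gen w) = vec (w.word.lmul c) (w.admissible.lmul c) :=
  (kernel E k m l).extend_gen _ _

theorem ip_gen_lamPre_gen (c : A k) (w w' : Elem E k m l) :
    (kernel E k m l).ip ((kernel E k m l).gen w) (lamPre c ((kernel E k m l).gen w')) =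
      gram E 1 w.word (w'.word.lmul c) := by
  rw [lamPre_gen]; exact ip_vec w.word _ w.admissible _

theorem ip_vec_lamPre_vec (c : A k) (w w' : Word A l k m) (h : w.Admissible E)
    (h' : w'.Admissible E) :
    (kernel E k m l).ip (vec w h) (lamPre c (vec w' h')) = gram E 1 w (w'.lmul c) :=
  ip_gen_lamPre_gen c ⟨w, h⟩ ⟨w', h'⟩

theorem ip_lamPre (c : A k) (x y : (kernel E k m l).Pre) :
    (kernel E k m l).ip (lamPre c x) y = (kernel E k m l).ip x (lamPre (star c) y) := by
  refine ip_adj (fun w w' => ?_) x y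
  rw [ip_gen_lamPre_gen, lamPre_gen]
  exact (ip_vec _ w'.word _ w'.admissible).trans (gram_lmul E c w.word w'.word)

theorem lamPre_mul (c d : A k) (x : (kernel E k m l).Pre) :
    lamPre (c * d) x = lamPre c (lamPre d x) := by
  refine LinearMap.congr_fun (f := lamPre (c * d)) (g := lamPre c ∘ₗ lamPre d)
    (ModuleKernel.hom_ext _ fun w => ?_) x
  rw [LinearMap.comp_apply, lamPre_gen, lamPre_gen]
  refine Eq.trans ?_ (lamPre_gen c (⟨w.word.lmul d, w.admissible.lmul d⟩ : Elem E k m l)).symm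
  simp only [lmul_mul]

theorem lamPre_one (x : (kernel E k m l).Pre) : lamPre 1 x = x := by
  refine LinearMap.congr_fun (f := lamPre 1) (g := LinearMap.id)
    (ModuleKernel.hom_ext _ fun w => ?_) x
  rw [lamPre_gen]
  simp only [lmul_one]
  rfl

theorem ip_lamPre_add (c d : A k) (x y : (kernel E k m l).Pre) :
    (kernel E k m l).ip x (lamPre (c + d) y) = (kernel E k m l).ip x ((lamPre c + lamPre d : (kernel E k m l).Pre →ₗ[ℂ] _) y) := by
  refine ip_congr (fun w w' => ?_) x y
  rw [LinearMap.add_apply, map_add, ip_gen_lamPre_gen, ip_gen_lamPre_gen, ip_gen_lamPre_gen,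
    gram_lmul_add]

theorem ip_lamPre_smul (z : ℂ) (c : A k) (x y : (kernel E k m l).Pre) :
    (kernel E k m l).ip x (lamPre (z • c) y) = (kernel E k m l).ip x ((z • lamPre c) y) := by
  refine ip_congr (fun w w' => ?_) x y
  rw [LinearMap.smul_apply, map_smul, ip_gen_lamPre_gen, ip_gen_lamPre_gen, gram_lmul_smul]

theorem norm_lamPre_le (c : A k) (x : (kernel E k m l).Pre) : ‖lamPre c x‖ ≤ ‖c‖ * ‖x‖ := by
  have h0 : 0 ≤ ((‖c‖ ^ 2 : ℝ) : ℂ) • (1 : A k) - star c * c := by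
    rw [sub_nonneg]
    have h := CStarAlgebra.star_mul_le_algebraMap_norm_sq (a := c)
    rwa [Algebra.algebraMap_eq_smul_one, ← Complex.coe_smul] at h
  obtain ⟨d, hd⟩ := CStarAlgebra.nonneg_iff_eq_star_mul_self.1 h0
  have h1 := (kernel E k m l).ip_self_nonneg (lamPre d x)
  rw [ip_lamPre, ← lamPre_mul, ← hd] at h1
  have h2 := ip_lamPre_add (((‖c‖ ^ 2 : ℝ) : ℂ) • (1 : A k) - star c * c) (star c * c) x x
  rw [sub_add_cancel, ip_lamPre_smul, LinearMap.smul_apply, lamPre_one, map_smul,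
    LinearMap.add_apply, map_add, lamPre_mul, ← ip_lamPre] at h2
  have h3 : (kernel E k m l).ip (lamPre c x) (lamPre c x) ≤
      ((‖c‖ ^ 2 : ℝ) : ℂ) • (kernel E k m l).ip x x := by
    rw [h2]; exact le_add_of_nonneg_left h1
  have h4 := CStarAlgebra.norm_le_norm_of_nonneg_of_le
    ((kernel E k m l).ip_self_nonneg (lamPre c x)) h3
  rw [norm_smul, ← pre_norm_sq, ← pre_norm_sq, Complex.norm_real,
    Real.norm_of_nonneg (by positivity), ← mul_pow] at h4
  exact (sq_le_sq₀ (norm_nonneg _) (by positivity)).1 h4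

/-- The left action of `c : A k`, as a bounded operator. -/
noncomputable def lamL (c : A k) : (kernel E k m l).Pre →L[ℂ] (kernel E k m l).Pre :=
  (lamPre c).mkContinuous ‖c‖ (norm_lamPre_le c)

theorem inner_lamL (c : A k) (x y : H E k m l) : inner (A l)ᵐᵒᵖ (mapL (lamL c) x) y =
    inner (A l)ᵐᵒᵖ x (mapL (lamL (star c)) y) :=
  inner_mapL (f := lamL c) (g := lamL (star c)) (fun x y => ip_lamPre c x y) x y

/-- The left action of `c : A k`, as an adjointable operator of the Hilbert module. -/
noncomputable def lamOp (c : A k) : Adjointable (A l)ᵐᵒᵖ (H E k m l) :=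
  ⟨mapL (lamL c), mapL (lamL (star c)), inner_lamL c⟩

theorem lamOp_coe (c : A k) (x : (kernel E k m l).Pre) :
    (lamOp c).1 ((kernel E k m l).toModule x) = (kernel E k m l).toModule (lamPre c x) :=
  mapL_coe _ _

theorem star_lamOp (c : A k) : star (lamOp c : Adjointable (A l)ᵐᵒᵖ (H E k m l)) = lamOp (star c) :=
  Adjointable.star_eq_of_inner (T := lamOp c) (S := lamOp (star c)) (inner_lamL c)

variable (E k m l)

/-- The left action of `A k` on `H E k m l`: on elementary tensors, `c` acts by multiplication of
the first entry. -/
noncomputable def lam : A k →⋆ₐ[ℂ] Adjointable (A l)ᵐᵒᵖ (H E k m l) where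
  toFun c := lamOp c
  map_one' := Adjointable.ext_apply <| mapL_ext (g := .id ℂ _) fun x => by
    rw [lamOp_coe]
    exact congrArg _ (lamPre_one x)
  map_mul' c d := Adjointable.ext_apply <|
    mapL_ext (g := (lamOp c).1.comp (lamOp d).1) fun x => by
      rw [ContinuousLinearMap.comp_apply, lamOp_coe, lamOp_coe, lamOp_coe]
      exact congrArg _ (lamPre_mul c d x)
  map_zero' := Adjointable.ext_apply <| mapL_ext (g := 0) fun x => by
    rw [lamOp_coe, _root_.zero_apply, ← map_zero (kernel E k m l).toModule]
    refine toModule_eq fun z => ?_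
    have := ip_lamPre_smul 0 (0 : A k) z x
    rwa [zero_smul, zero_smul, LinearMap.zero_apply] at this
  map_add' c d := Adjointable.ext_apply <|
    mapL_ext (g := (lamOp c).1 + (lamOp d).1) fun x => by
      rw [_root_.add_apply, lamOp_coe, lamOp_coe, lamOp_coe, ← map_add]
      exact toModule_eq fun z => ip_lamPre_add c d z x
  commutes' z := Adjointable.ext_apply <| mapL_ext (g := z • .id ℂ _) fun x => by
    rw [lamOp_coe, _root_.smul_apply, ContinuousLinearMap.id_apply, ← map_smul]
    refine toModule_eq fun y => ?_
    rw [Algebra.algebraMap_eq_smul_one, ip_lamPre_smul, LinearMap.smul_apply, lamPre_one]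
  map_star' c := (star_lamOp c).symm

/-! ### The unitaries -/

variable {E k m l}

/-- The unitary `U E k m l` on an elementary tensor. -/
noncomputable def uElem : {k m : ι} → (w : Word A l k m) → w.Admissible E → (kernel E m k l).Pre
  | _, _, last a, _ => vec (cons 1 (last a)) (admissible_cons_last 1 a)
  | k, m, cons a t, h => vec (cons 1 (cons (a - j k (E k a)) t)) (admissible_cons_cons 1 ((E k).apply_sub_self a) h.tail) +
      vec (t.lmul (j m (E k a))) (h.tail.admissible_lmul _)

theorem uElem_last {m : ι} (a : A l) (h : (last a : Word A l l m).Admissible E) :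
    uElem (last a) h = vec (cons 1 (last a)) (admissible_cons_last 1 a) := by
  rw [uElem]

theorem uElem_cons {k m : ι} (a : A k) (t : Word A l m k) (h : (cons a t).Admissible E) :
    uElem (cons a t) h =
      vec (cons 1 (cons (a - j k (E k a)) t)) (admissible_cons_cons 1 ((E k).apply_sub_self a) h.tail) +
      vec (t.lmul (j m (E k a))) (h.tail.admissible_lmul _) := by
  rw [uElem]

/-- The unitary `U E k m l` on formal linear combinations of elementary tensors. -/
noncomputable def uPre : (kernel E k m l).Pre →ₗ[ℂ] (kernel E m k l).Pre :=
  (kernel E k m l).extend fun w => uElem w.word w.admissible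

theorem uPre_gen (w : Elem E k m l) : uPre ((kernel E k m l).gen w) = uElem w.word w.admissible :=
  (kernel E k m l).extend_gen _ _

theorem uPre_vec (w : Word A l k m) (h : w.Admissible E) : uPre (vec w h) = uElem w h :=
  (kernel E k m l).extend_gen _ _

theorem gram_centered (β : B) : ∀ {k m : ι} (a : A k) (t : Word A l m k) (t' : Word A l k m),
    t'.Centered E → gram E β (cons (a - j k (E k a)) t) t' =
      gram E 1 (cons a t) (t'.lmul (j k β))
  | _, _, _, _, last _, _ => by simp only [gram, Word.lmul]
  | k, _, _, _, cons c s, h => by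
    have hc : E k c = 0 := h.1
    simp only [gram, Word.lmul, map_one, mul_one, star_sub, sub_mul, map_sub, ← map_star,
      ← map_mul, mul_assoc, (E k).apply_incl_mul, hc, mul_zero, sub_zero]

theorem ip_uElem : ∀ {k m : ι} (w : Word A l k m) (h : w.Admissible E) (w' : Word A l m k)
    (h' : w'.Admissible E), (kernel E m k l).ip (uElem w h) (vec w' h') =
      (kernel E k m l).ip (vec w h) (uElem w' h')
  | _, _, last a, h, last a', h' => by
    simp only [uElem, ip_vec, gram]
  | _, _, last a, h, cons a' t', h' => by
    simp only [uElem, ip_vec, map_add, gram, star_one, map_one, one_mul, zero_add, mul_one]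
    rw [gram_eq_lmul]
  | _, _, cons a t, h, last a', h' => by
    simp only [uElem, ip_vec, map_add, LinearMap.add_apply, gram, map_one, mul_one, zero_add,
      gram_lmul, ← map_star, ConditionalExpectation.apply_star]
    rw [← gram_eq_lmul]
  | k, m, cons a t, h, cons a' t', h' => by
    simp only [uElem, ip_vec, map_add, LinearMap.add_apply]
    have e1 := gram_centered (E m a') a t t' h'
    have e2 := congrArg star (gram_centered (E k a) a' t' t h)
    rw [star_gram, star_gram, star_one] at e2
    rw [← e1, ← e2]
    simp only [gram, star_one, map_one, one_mul, mul_one, ConditionalExpectation.apply_star]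
    rw [add_comm]

theorem ip_uPre (x : (kernel E k m l).Pre) (y : (kernel E m k l).Pre) :
    (kernel E m k l).ip (uPre x) y = (kernel E k m l).ip x (uPre y) := by
  refine ip_adj (fun w w' => ?_) x y
  rw [uPre_gen, uPre_gen]
  exact ip_uElem w.word w.admissible w'.word w'.admissible

theorem gram_split : ∀ {k m : ι} (a : A k) (t : Word A l m k) (w : Word A l k m),
    gram E 1 w (cons (a - j k (E k a)) t) + gram E 1 w (cons 1 (t.lmul (j m (E k a)))) =
      gram E 1 w (cons a t)
  | _, _, _, _, last _ => by simp only [gram, add_zero]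
  | k, _, _, _, cons c s => by
    simp only [gram, map_one, mul_one, ← gram_mul]
    rw [← ConditionalExpectation.apply_mul_incl, ← gram_add, ← map_add, mul_sub, sub_add_cancel]

theorem gram_cons_zero : ∀ {k m : ι} (t : Word A l m k) (w : Word A l k m),
    gram E 1 w (cons 0 t) = 0
  | _, _, _, last _ => by simp only [gram]
  | _, _, _, cons _ _ => by simp only [gram, mul_zero, map_zero, gram_zero]

theorem gram_cons_one_cons_zero : ∀ {k m : ι} (t : Word A l k m) (w : Word A l k m),
    gram E 1 w (cons 1 (cons 0 t)) = 0
  | _, _, _, last _ => by simp only [gram]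
  | _, _, _, cons c (last _) => by simp only [gram]
  | _, _, _, cons c (cons _ _) => by simp only [gram, mul_zero, map_zero, gram_zero]

/-- `1 ⊗ b y` and `b ⊗ y` are the same vector. -/
theorem gram_cons_swap (b : B) : ∀ {k m : ι} (v : Word A l m k) (w : Word A l k m),
    gram E 1 v (cons 1 (w.lmul (j k b))) = gram E 1 v ((cons 1 w).lmul (j m b))
  | _, _, last _, _ => by simp only [gram, Word.lmul]
  | _, _, cons c s, w => by
    rw [gram, Word.lmul, gram, map_one, mul_one, mul_one, mul_one]
    rw [← gram_mul, ConditionalExpectation.apply_mul_incl]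

theorem ip_uPre_uElem : ∀ {k m : ι} (w w' : Word A l k m) (h : w.Admissible E)
    (h' : w'.Admissible E),
    (kernel E k m l).ip (vec w h) (uPre (uElem w' h')) = gram E 1 w w'
  | _, _, w, last a, h, h' => by
    rw [uElem_last, uPre_vec, uElem_cons, map_add, ip_vec, ip_vec, ConditionalExpectation.apply_one,
      map_one, sub_self, gram_cons_one_cons_zero, map_one, lmul_one, zero_add]
  | _, _, w, cons a (last c), h, h' => by
    rw [uElem_cons, map_add, uPre_vec, uElem_cons, map_add, map_add, ip_vec, ip_vec,
      ConditionalExpectation.apply_one, map_one, sub_self, gram_cons_one_cons_zero, map_one, lmul_one,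
      zero_add, ← gram_split (E := E) a (last c) w]
    congr 1
    exact (congrArg _ (uPre_vec _ _)).trans (ip_vec _ _ _ _)
  | k, m, w, cons a (cons c s), h, h' => by
    have hc : E m (j m (E k a) * c) = 0 := by
      rw [(E m).apply_incl_mul, h'.tail.head, mul_zero]
    rw [uElem_cons, map_add, uPre_vec, uElem_cons, map_add, map_add, ip_vec, ip_vec,
      ConditionalExpectation.apply_one, map_one, sub_self, gram_cons_one_cons_zero, map_one, lmul_one,
      zero_add, ← gram_split (E := E) a (cons c s) w]
    congr 1
    refine (congrArg _ (uPre_vec _ _)).trans ?_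
    refine (congrArg _ (uElem_cons (j m (E k a) * c) s _)).trans ?_
    rw [map_add, ip_vec, ip_vec, hc, ← gram_mul, mul_zero, gram_zero, add_zero, map_zero,
      sub_zero, Word.lmul]

theorem ip_uPre_uPre (x y : (kernel E k m l).Pre) :
    (kernel E k m l).ip x (uPre (uPre y)) = (kernel E k m l).ip x y := by
  refine ip_congr (f := uPre ∘ₗ uPre) (g := .id) (fun w w' => ?_) x y
  rw [LinearMap.comp_apply, uPre_gen, LinearMap.id_apply]
  exact (ip_uPre_uElem w.word w'.word w.admissible w'.admissible).trans (ip_vec _ _ w.admissible w'.admissible).symm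

/-- The unitary `U E k m l` on formal linear combinations, as a bounded operator. -/
noncomputable def uL : (kernel E k m l).Pre →L[ℂ] (kernel E m k l).Pre :=
  uPre.mkContinuous 1 fun x => by
    rw [one_mul, pre_norm_def, pre_norm_def, ip_uPre, ip_uPre_uPre]

variable (E k m l)

/-- The unitary `H E k m l → H E m k l`, which maps `a ⊗ ξ` to `1 ⊗ a ⊗ ξ` if `E k a = 0` and to
`b ξ` if `a = b ∈ B`, and which maps `ξ` to `1 ⊗ ξ` if `ξ` is an elementary tensor of
length one. -/
noncomputable def U : H E k m l →L[ℂ] H E m k l := mapL uL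

theorem inner_U (x : H E k m l) (y : H E m k l) :
    inner (A l)ᵐᵒᵖ (U E k m l x) y = inner (A l)ᵐᵒᵖ x (U E m k l y) :=
  inner_mapL (f := uL) (g := uL) (fun x y => ip_uPre x y) x y

theorem U_U (x : H E k m l) : U E m k l (U E k m l x) = x :=
  mapL_ext (f := (U E m k l).comp (U E k m l)) (g := .id ℂ _) (fun x => by
    rw [ContinuousLinearMap.comp_apply, U, U, mapL_coe, mapL_coe]
    exact toModule_eq fun y => ip_uPre_uPre y x) x

variable {E k m l}

theorem ip_uElem_incl (b : B) : ∀ {k m : ι} (w : Word A l k m) (h : w.Admissible E)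
    (v : Word A l m k) (hv : v.Admissible E),
    (kernel E m k l).ip (vec v hv) (uElem (w.lmul (j k b)) (h.lmul _)) =
      (kernel E m k l).ip (vec v hv) (lamPre (j m b) (uElem w h))
  | _, _, last a, h, v, hv => by
    rw [uElem_last, ip_vec_lamPre_vec]
    refine (congrArg _ (uElem_last (j _ b * a) h)).trans ((ip_vec _ _ _ _).trans ?_)
    exact gram_cons_swap b v (last a)
  | k, m, cons a t, h, v, hv => by
    rw [uElem_cons, map_add, map_add, ip_vec_lamPre_vec, ip_vec_lamPre_vec]
    refine (congrArg _ (uElem_cons (j k b * a) t h)).trans ?_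
    rw [map_add, ip_vec, ip_vec, (E k).apply_incl_mul, map_mul, map_mul, lmul_mul, ← mul_sub]
    congr 1
    exact gram_cons_swap b v (cons (a - j k (E k a)) t)

theorem ip_uPre_lamPre_incl (b : B) (y : (kernel E m k l).Pre) (x : (kernel E k m l).Pre) :
    (kernel E m k l).ip y (uPre (lamPre (j k b) x)) =
      (kernel E m k l).ip y (lamPre (j m b) (uPre x)) := by
  refine ip_congr (f := uPre ∘ₗ lamPre (j k b)) (g := lamPre (j m b) ∘ₗ uPre) (fun v w => ?_) y x
  rw [LinearMap.comp_apply, LinearMap.comp_apply, lamPre_gen, uPre_vec, uPre_gen]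
  exact ip_uElem_incl b w.word w.admissible v.word v.admissible

/-- `U* λ(b) U = λ(b)` for `b ∈ B`. -/
theorem U_lam_incl (b : B) (x : H E k m l) :
    U E m k l ((lam E m k l (j m b)).1 (U E k m l x)) = (lam E k m l (j k b)).1 x := by
  rw [← U_U E k m l ((lam E k m l (j k b)).1 x)]
  refine congrArg _ (mapL_ext (f := (lam E m k l (j m b)).1.comp (U E k m l))
    (g := (U E k m l).comp (lam E k m l (j k b)).1) (fun x => ?_) x)
  change mapL (lamL (j m b)) (mapL uL _) = mapL uL (mapL (lamL (j k b)) _)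
  rw [mapL_coe, mapL_coe, mapL_coe, mapL_coe]
  exact (toModule_eq fun y => ip_uPre_lamPre_incl b y x).symm

variable (E k m l)

/-- The left action of `A m` on `H E k m l` given by `c ↦ U* λ(c) U`. -/
noncomputable def lam' : A m →⋆ₐ[ℂ] Adjointable (A l)ᵐᵒᵖ (H E k m l) :=
  (Adjointable.conj (U E k m l) (U E m k l) (inner_U E k m l) (U_U E k m l)
    (U_U E m k l)).comp (lam E m k l)

theorem lam'_incl (b : B) : lam' E k m l (j m b) = lam E k m l (j k b) :=
  Adjointable.ext_apply (U_lam_incl b)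

end VertexModule

/-! ## The full amalgamated free product -/

section FreeStar

variable (X : Type*)

/-- The free complex unital `*`-algebra on a set `X` of generators that carries an involution. -/
def FreeStar : Type _ := FreeAlgebra ℂ X

namespace FreeStar

instance : Ring (FreeStar X) := inferInstanceAs (Ring (FreeAlgebra ℂ X))
instance : Algebra ℂ (FreeStar X) := inferInstanceAs (Algebra ℂ (FreeAlgebra ℂ X))

variable {X}

/-- The generators. -/
def of (x : X) : FreeStar X := FreeAlgebra.ι ℂ x

theorem induction {Q : FreeStar X → Prop} (h1 : ∀ c, Q (algebraMap ℂ _ c)) (h2 : ∀ x, Q (of x))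
    (h3 : ∀ x y, Q x → Q y → Q (x * y)) (h4 : ∀ x y, Q x → Q y → Q (x + y)) (x : FreeStar X) :
    Q x :=
  FreeAlgebra.induction ℂ X h1 h2 h3 h4 x

/-- The extension of a map on generators to an algebra homomorphism. -/
noncomputable def liftAlg {C : Type*} [Ring C] [Algebra ℂ C] (f : X → C) : FreeStar X →ₐ[ℂ] C :=
  FreeAlgebra.lift ℂ f

theorem liftAlg_of {C : Type*} [Ring C] [Algebra ℂ C] (f : X → C) (x : X) :
    liftAlg f (of x) = f x :=
  FreeAlgebra.lift_ι_apply f x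

variable [InvolutiveStar X]

/-- The involution, as a ring homomorphism to the opposite ring. -/
noncomputable def starHom : FreeStar X →+* (FreeStar X)ᵐᵒᵖ :=
  letI : Algebra ℂ (FreeStar X)ᵐᵒᵖ := Algebra.compHom _ (starRingEnd ℂ)
  (liftAlg fun x => MulOpposite.op (of (star x)) : FreeStar X →ₐ[ℂ] (FreeStar X)ᵐᵒᵖ).toRingHom

/-- The involution: the conjugate linear antimultiplicative map extending the involution of the
generators. -/
noncomputable instance : Star (FreeStar X) := ⟨fun x => (starHom x).unop⟩

theorem star_def (x : FreeStar X) : star x = (starHom x).unop := rfl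

theorem star_of (x : X) : star (of x) = of (star x) := by
  let _ : Algebra ℂ (FreeStar X)ᵐᵒᵖ := Algebra.compHom _ (starRingEnd ℂ)
  exact congrArg MulOpposite.unop
    (liftAlg_of (fun x => MulOpposite.op (of (star x)) : X → (FreeStar X)ᵐᵒᵖ) x)

theorem star_algebraMap (c : ℂ) :
    star (algebraMap ℂ (FreeStar X) c) = algebraMap ℂ (FreeStar X) (star c) := by
  let _ : Algebra ℂ (FreeStar X)ᵐᵒᵖ := Algebra.compHom _ (starRingEnd ℂ)
  exact congrArg MulOpposite.unop
    ((liftAlg fun x => MulOpposite.op (of (star x)) : FreeStar X →ₐ[ℂ] (FreeStar X)ᵐᵒᵖ).commutes c)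

theorem star_mul_aux (x y : FreeStar X) : star (x * y) = star y * star x := by
  rw [star_def, map_mul]; rfl

theorem star_add_aux (x y : FreeStar X) : star (x + y) = star x + star y := by
  rw [star_def, map_add]; rfl

noncomputable instance : StarRing (FreeStar X) where
  star_involutive x := by
    refine induction (Q := fun x => star (star x) = x) (fun c => ?_) (fun x => ?_)
      (fun x y hx hy => ?_) (fun x y hx hy => ?_) x
    · rw [star_algebraMap, star_algebraMap, star_star]
    · rw [star_of, star_of, star_star]
    · rw [star_mul_aux, star_mul_aux, hx, hy]
    · rw [star_add_aux, star_add_aux, hx, hy]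
  star_mul := star_mul_aux
  star_add := star_add_aux

instance : StarModule ℂ (FreeStar X) where
  star_smul c x := by
    rw [Algebra.smul_def, star_mul, star_algebraMap, Algebra.smul_def, Algebra.commutes]

/-- The extension of a `*`-preserving map on generators to a `*`-homomorphism. -/
noncomputable def lift {C : Type*} [CStarAlgebra C] (f : X → C) (hf : ∀ x, f (star x) = star (f x)) :
    FreeStar X →⋆ₐ[ℂ] C :=
  { liftAlg f with
    map_star' := fun x => by
      change liftAlg f (star x) = star (liftAlg f x)
      refine induction (Q := fun x => liftAlg f (star x) = star (liftAlg f x)) (fun c => ?_)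
        (fun x => ?_) (fun x y hx hy => ?_) (fun x y hx hy => ?_) x
      · rw [star_algebraMap, AlgHom.commutes, AlgHom.commutes, algebraMap_star_comm]
      · rw [star_of, liftAlg_of, liftAlg_of, hf]
      · rw [star_mul, map_mul, map_mul, hx, hy, star_mul]
      · rw [star_add, map_add, map_add, hx, hy, star_add] }

theorem lift_of {C : Type*} [CStarAlgebra C] (f : X → C) (hf : ∀ x, f (star x) = star (f x))
    (x : X) : lift f hf (of x) = f x :=
  liftAlg_of f x

end FreeStar

end FreeStar

section FullAmalgam

variable {ι : Type} {A : ι → Type*} {B : Type*} [∀ k, CStarAlgebra (A k)] [CStarAlgebra B]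

instance : InvolutiveStar (Σ k, A k) where
  star x := ⟨x.1, star x.2⟩
  star_involutive x := by
    change (⟨x.1, star (star x.2)⟩ : Σ k, A k) = x
    rw [star_star]

/-- The generator of the free `*`-algebra given by an element of `A k`. -/
def freeGen (k : ι) (a : A k) : FreeStar (Σ k, A k) := FreeStar.of ⟨k, a⟩

theorem star_freeGen (k : ι) (a : A k) : star (freeGen k a) = freeGen k (star a) :=
  FreeStar.star_of _

/-- The C*-seminorms on the free `*`-algebra on the disjoint union of the `A k` that come from
unital `*`-homomorphisms `A k → C` to a C*-algebra which agree on `B`: those modulo which the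
generators satisfy the relations of the `A k` and the copies of `B` are identified. -/
structure AmalgamSeminorm (j : ∀ k, B →⋆ₐ[ℂ] A k) extends CStarSeminorm (FreeStar (Σ k, A k)) where
  rel_add : ∀ k (a b : A k), toFun (freeGen k (a + b) - (freeGen k a + freeGen k b)) = 0
  rel_smul : ∀ k (c : ℂ) (a : A k), toFun (freeGen k (c • a) - c • freeGen k a) = 0
  rel_mul : ∀ k (a b : A k), toFun (freeGen k (a * b) - freeGen k a * freeGen k b) = 0
  rel_one : ∀ k, toFun (freeGen k 1 - 1) = 0
  rel_incl : ∀ k k' (b : B), toFun (freeGen k (j k b) - freeGen k' (j k' b)) = 0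

namespace AmalgamSeminorm

variable {j : ∀ k, B →⋆ₐ[ℂ] A k}

/-- The homomorphism of `A k` to the completion for an amalgam seminorm. -/
noncomputable def gen (p : AmalgamSeminorm j) (k : ι) : A k →⋆ₐ[ℂ] p.toCStarSeminorm.Completion :=
  have key : ∀ x y : FreeStar (Σ k, A k), p.toFun (x - y) = 0 →
      p.toCStarSeminorm.toCompletion x = p.toCStarSeminorm.toCompletion y := fun x y h => by
    rw [← sub_eq_zero, ← map_sub, ← norm_eq_zero]
    exact (p.toCStarSeminorm.norm_coe _).trans h
  { toFun := fun a => p.toCStarSeminorm.toCompletion (freeGen k a)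
    map_one' := by rw [key _ _ (p.rel_one k), map_one]
    map_mul' := fun a b => by rw [key _ _ (p.rel_mul k a b), map_mul]
    map_zero' := by
      have := key _ _ (p.rel_smul k 0 0)
      rwa [zero_smul, zero_smul, map_zero] at this
    map_add' := fun a b => by rw [key _ _ (p.rel_add k a b), map_add]
    commutes' := fun c => by
      rw [Algebra.algebraMap_eq_smul_one, key _ _ (p.rel_smul k c 1), map_smul,
        key _ _ (p.rel_one k), map_one, Algebra.algebraMap_eq_smul_one]
    map_star' := fun a => by rw [← star_freeGen, map_star] }

theorem gen_apply (p : AmalgamSeminorm j) (k : ι) (a : A k) :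
    p.gen k a = p.toCStarSeminorm.toCompletion (freeGen k a) := rfl

theorem gen_incl (p : AmalgamSeminorm j) (k k' : ι) (b : B) : p.gen k (j k b) = p.gen k' (j k' b) := by
  rw [← sub_eq_zero, gen_apply, gen_apply, ← map_sub, ← norm_eq_zero]
  exact (p.toCStarSeminorm.norm_coe _).trans (p.rel_incl k k' b)

theorem apply_freeGen_le (p : AmalgamSeminorm j) (k : ι) (a : A k) : p.toFun (freeGen k a) ≤ ‖a‖ :=
  (p.toCStarSeminorm.norm_coe _).symm.le.trans (NonUnitalStarAlgHom.norm_apply_le (p.gen k) a)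

/-- A compatible family of `*`-homomorphisms gives an amalgam seminorm. -/
noncomputable def ofHom {C : Type*} [CStarAlgebra C] (f : ∀ k, A k →⋆ₐ[ℂ] C)
    (hf : ∀ k k' b, f k (j k b) = f k' (j k' b)) : AmalgamSeminorm j :=
  have hs : ∀ x : Σ k, A k, f (star x).1 (star x).2 = star (f x.1 x.2) := fun x =>
    map_star (f x.1) x.2
  let F := FreeStar.lift (fun x : Σ k, A k => f x.1 x.2) hs
  have key : ∀ k a, F (freeGen k a) = f k a := fun k a => FreeStar.lift_of _ _ _
  have key' : ∀ x, F x = 0 → (CStarSeminorm.ofHom F).toFun x = 0 := fun x h => norm_eq_zero.2 h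
  { CStarSeminorm.ofHom F with
    rel_add := fun k a b => key' _ (by rw [map_sub, map_add, key, key, key, map_add, sub_self])
    rel_smul := fun k c a => key' _ (by rw [map_sub, map_smul, key, key, map_smul, sub_self])
    rel_mul := fun k a b => key' _ (by rw [map_sub, map_mul, key, key, key, map_mul, sub_self])
    rel_one := fun k => key' _ (by rw [map_sub, key, map_one, map_one, sub_self])
    rel_incl := fun k k' b => key' _ (by rw [map_sub, key, key, hf k k', sub_self]) }

instance : Nonempty (AmalgamSeminorm j) :=
  ⟨{ toSeminorm := 0
     mul_le' := fun _ _ => (mul_zero (0 : ℝ)).ge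
     star_mul_self' := fun _ => (mul_zero (0 : ℝ)).symm
     rel_add := fun _ _ _ => rfl
     rel_smul := fun _ _ _ => rfl
     rel_mul := fun _ _ _ => rfl
     rel_one := fun _ => rfl
     rel_incl := fun _ _ _ => rfl }⟩

variable (j) in
theorem bounded (x : FreeStar (Σ k, A k)) :
    BddAbove (Set.range fun p : AmalgamSeminorm j => p.toCStarSeminorm x) := by
  suffices h : ∃ M, ∀ p : AmalgamSeminorm j, p.toCStarSeminorm x ≤ M from
    ⟨h.choose, by rintro _ ⟨p, rfl⟩; exact h.choose_spec p⟩
  refine FreeStar.induction (Q := fun x => ∃ M, ∀ p : AmalgamSeminorm j, p.toCStarSeminorm x ≤ M)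
    (fun c => ⟨‖algebraMap ℂ ℂ c‖, fun p => ?_⟩) (fun x => ⟨‖x.2‖, fun p => p.apply_freeGen_le x.1 x.2⟩)
    ?_ ?_ x
  · rw [← p.toCStarSeminorm.norm_coe, CStarSeminorm.coe_algebraMap]
    refine (NonUnitalStarAlgHom.norm_apply_le
      (StarAlgHom.ofId ℂ p.toCStarSeminorm.Completion) c)
  · rintro x y ⟨M, hM⟩ ⟨N, hN⟩
    exact ⟨M * N, fun p => (p.toCStarSeminorm.mul_le x y).trans
      (mul_le_mul (hM p) (hN p) (apply_nonneg p.toSeminorm y)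
        ((apply_nonneg p.toSeminorm x).trans (hM p)))⟩
  · rintro x y ⟨M, hM⟩ ⟨N, hN⟩
    exact ⟨M + N, fun p => (map_add_le_add p.toSeminorm x y).trans (add_le_add (hM p) (hN p))⟩

variable (j) in
/-- The largest amalgam seminorm. -/
noncomputable def max : AmalgamSeminorm j :=
  have h0 : ∀ x, (∀ p : AmalgamSeminorm j, p.toFun x = 0) →
      ⨆ p : AmalgamSeminorm j, p.toCStarSeminorm x = 0 := fun x h =>
    (congrArg _ (funext h)).trans ciSup_const
  { CStarSeminorm.iSup (fun p : AmalgamSeminorm j => p.toCStarSeminorm) (bounded j) with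
    rel_add := fun k a b => h0 _ fun p => p.rel_add k a b
    rel_smul := fun k c a => h0 _ fun p => p.rel_smul k c a
    rel_mul := fun k a b => h0 _ fun p => p.rel_mul k a b
    rel_one := fun k => h0 _ fun p => p.rel_one k
    rel_incl := fun k k' b => h0 _ fun p => p.rel_incl k k' b }

theorem le_max (p : AmalgamSeminorm j) (x : FreeStar (Σ k, A k)) :
    p.toCStarSeminorm x ≤ (max j).toCStarSeminorm x :=
  le_ciSup (bounded j x) p

end AmalgamSeminorm

/-- The full amalgamated free product of the unital C*-algebras `A k` over their common unital
C*-subalgebra `B`. -/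
abbrev FullAmalgam (j : ∀ k, B →⋆ₐ[ℂ] A k) : Type _ :=
  (AmalgamSeminorm.max j).toCStarSeminorm.Completion

namespace FullAmalgam

/-- The canonical homomorphisms to the full amalgamated free product. -/
noncomputable def of (j : ∀ k, B →⋆ₐ[ℂ] A k) (k : ι) : A k →⋆ₐ[ℂ] FullAmalgam j :=
  (AmalgamSeminorm.max j).gen k

variable {j : ∀ k, B →⋆ₐ[ℂ] A k}

theorem of_incl (k k' : ι) (b : B) : of j k (j k b) = of j k' (j k' b) :=
  (AmalgamSeminorm.max j).gen_incl k k' b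

variable {C : Type*} [CStarAlgebra C]

/-- The universal property of the full amalgamated free product. -/
noncomputable def lift (f : ∀ k, A k →⋆ₐ[ℂ] C) (hf : ∀ k k' b, f k (j k b) = f k' (j k' b)) :
    FullAmalgam j →⋆ₐ[ℂ] C :=
  CStarSeminorm.lift (FreeStar.lift (fun x : Σ k, A k => f x.1 x.2) fun x => map_star (f x.1) x.2)
    (AmalgamSeminorm.ofHom f hf).le_max

theorem lift_of (f : ∀ k, A k →⋆ₐ[ℂ] C) (hf : ∀ k k' b, f k (j k b) = f k' (j k' b)) (k : ι)
    (a : A k) : lift f hf (of j k a) = f k a :=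
  (CStarSeminorm.lift_toCompletion _ _ _).trans (FreeStar.lift_of _ _ _)

end FullAmalgam

end FullAmalgam

/-! ## The vertex-reduced amalgamated free product -/

section VertexReduced

open VertexModule

variable {A : Fin 2 → Type*} {B : Type*} [∀ k, CStarAlgebra (A k)]
  [∀ k, PartialOrder (A k)] [∀ k, StarOrderedRing (A k)]
  [CStarAlgebra B] [PartialOrder B] [StarOrderedRing B]
  {j : ∀ k, B →⋆ₐ[ℂ] A k} (E : ∀ k, ConditionalExpectation (j k))

/-- The actions of `A 0` and `A 1` on `H E 0 1 0`: `λ` on `A 0`, and `U* λ U` on `A 1`. -/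
noncomputable def vertexAction₀ : ∀ i, A i →⋆ₐ[ℂ] Adjointable (A 0)ᵐᵒᵖ (H E 0 1 0)
  | 0 => lam E 0 1 0
  | 1 => lam' E 0 1 0

theorem vertexAction₀_incl (b : B) : ∀ i i' : Fin 2,
    vertexAction₀ E i (j i b) = vertexAction₀ E i' (j i' b)
  | 0, 0 => rfl
  | 0, 1 => (lam'_incl E 0 1 0 b).symm
  | 1, 0 => lam'_incl E 0 1 0 b
  | 1, 1 => rfl

/-- The representation of the full amalgamated free product on `H E 0 1 0`, whose image is the
vertex-reduced amalgamated free product relative to the vertex `0`. -/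
noncomputable def vertexRep₀ : FullAmalgam j →⋆ₐ[ℂ] Adjointable (A 0)ᵐᵒᵖ (H E 0 1 0) :=
  FullAmalgam.lift (vertexAction₀ E) fun i i' b => vertexAction₀_incl E b i i'

/-- The actions of `A 0` and `A 1` on `H E 1 0 1`: `U* λ U` on `A 0`, and `λ` on `A 1`. -/
noncomputable def vertexAction₁ : ∀ i, A i →⋆ₐ[ℂ] Adjointable (A 1)ᵐᵒᵖ (H E 1 0 1)
  | 0 => lam' E 1 0 1
  | 1 => lam E 1 0 1

theorem vertexAction₁_incl (b : B) : ∀ i i' : Fin 2,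
    vertexAction₁ E i (j i b) = vertexAction₁ E i' (j i' b)
  | 0, 0 => rfl
  | 0, 1 => lam'_incl E 1 0 1 b
  | 1, 0 => (lam'_incl E 1 0 1 b).symm
  | 1, 1 => rfl

/-- The representation of the full amalgamated free product on `H E 1 0 1`, whose image is the
vertex-reduced amalgamated free product relative to the vertex `1`. -/
noncomputable def vertexRep₁ : FullAmalgam j →⋆ₐ[ℂ] Adjointable (A 1)ᵐᵒᵖ (H E 1 0 1) :=
  FullAmalgam.lift (vertexAction₁ E) fun i i' b => vertexAction₁_incl E b i i'

/-- The C*-seminorm `‖x‖ᵥ = max ‖π₀ x‖ ‖π₁ x‖` on the full amalgamated free product. -/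
noncomputable def vertexSeminorm : CStarSeminorm (FullAmalgam j) :=
  (CStarSeminorm.ofHom (vertexRep₀ E)).sup (CStarSeminorm.ofHom (vertexRep₁ E))

theorem vertexSeminorm_apply (x : FullAmalgam j) :
    vertexSeminorm E x = max ‖vertexRep₀ E x‖ ‖vertexRep₁ E x‖ := rfl

/-- The vertex-reduced amalgamated free product: the separation and completion of the full
amalgamated free product with respect to the vertex seminorm. -/
abbrev VertexReduced : Type _ := (vertexSeminorm E).Completion

/-- The canonical homomorphism of the full to the vertex-reduced amalgamated free product. -/
noncomputable def VertexReduced.mk : FullAmalgam j →⋆ₐ[ℂ] VertexReduced E :=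
  (vertexSeminorm E).toCompletion

/-- The fiber sum `{(a₀, a₁) : E₀ a₀ = E₁ a₁}` of `A 0` and `A 1` over `B`, a `*`-subalgebra of
`A 0 × A 1` if the conditional expectations are homomorphisms. -/
def fiberSum (hE : ∀ k a a', E k (a * a') = E k a * E k a') : StarSubalgebra ℂ (A 0 × A 1) where
  carrier := {x | E 0 x.1 = E 1 x.2}
  mul_mem' {x y} hx hy := by
    change E 0 (x.1 * y.1) = E 1 (x.2 * y.2)
    rw [hE, hE, hx, hy]
  add_mem' {x y} hx hy := by
    change E 0 (x.1 + y.1) = E 1 (x.2 + y.2)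
    rw [map_add, map_add, hx, hy]
  algebraMap_mem' c := by
    change E 0 (algebraMap ℂ (A 0) c) = E 1 (algebraMap ℂ (A 1) c)
    rw [Algebra.algebraMap_eq_smul_one, Algebra.algebraMap_eq_smul_one, map_smul, map_smul,
      (E 0).apply_one, (E 1).apply_one]
  star_mem' {x} hx := by
    change E 0 (star x.1) = E 1 (star x.2)
    rw [(E 0).apply_star, (E 1).apply_star, hx]

theorem mem_fiberSum (hE : ∀ k a a', E k (a * a') = E k a * E k a') (x : A 0 × A 1) :
    x ∈ fiberSum E hE ↔ E 0 x.1 = E 1 x.2 := Iff.rfl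

end VertexReduced

/-! When `E 0` and `E 1` are homomorphisms, an inner product of elementary tensors that involves a
middle entry `c` with `E c = 0` is zero, so all tensors of length at least three vanish in the
Hilbert modules `H E 0 1 0` and `H E 1 0 1`. What is left of `H E k m k` is a copy of `A k`, on which
`A k` acts by left multiplication and `A m` acts through `j k ∘ E m`
(`VertexModule.lam'_eq_lam`). Hence the vertex representation at `k` is the isometric
representation `lam E k m k` composed with the retraction `σ k` of the full amalgamated free
product onto `A k` (`retraction₀`, `retraction₁`), and `‖x‖ᵥ = ‖(σ 0 x, σ 1 x)‖`
(`vertexSeminorm_eq_norm_toFiberSum`).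

The map `x ↦ (σ 0 x, σ 1 x)` has values in the fiber sum, and it maps `a₀ + a₁ - b` to `(a₀, a₁)` if
`E 0 a₀ = b = E 1 a₁`, so it is onto and induces an isomorphism. As a consequence every element of
the vertex-reduced product is the class of some `a₀ + a₁ - b`, which gives the uniqueness. -/

/-! ### Homomorphisms on the full amalgamated free product -/

/-- The image of the free `*`-algebra is dense, and homomorphisms of C*-algebras are continuous, so
that homomorphisms are determined by their values on the generators. -/
theorem FullAmalgam.hom_ext {ι : Type} {A : ι → Type*} {B : Type*} [∀ k, CStarAlgebra (A k)]
    [CStarAlgebra B] {j : ∀ k, B →⋆ₐ[ℂ] A k} {C : Type*} [CStarAlgebra C]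
    {f g : FullAmalgam j →⋆ₐ[ℂ] C} (h : ∀ k a, f (of j k a) = g (of j k a)) : f = g := by
  have hc : ∀ f : FullAmalgam j →⋆ₐ[ℂ] C, Continuous f := fun f =>
    AddMonoidHomClass.continuous_of_bound f 1 fun x => by
      rw [one_mul]; exact NonUnitalStarAlgHom.norm_apply_le f x
  let p := (AmalgamSeminorm.max j).toCStarSeminorm
  refine StarAlgHom.ext fun x => ?_
  refine p.induction (Q := fun x => f x = g x) (isClosed_eq (hc f) (hc g)) (fun y => ?_) x
  refine FreeStar.induction (Q := fun y => f (p.coe y) = g (p.coe y)) (fun c => ?_)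
    (fun s => h s.1 s.2) (fun y z hy hz => ?_) (fun y z hy hz => ?_) y
  · rw [p.coe_algebraMap, AlgHomClass.commutes, AlgHomClass.commutes]
  · rw [p.coe_mul, map_mul, map_mul, hy, hz]
  · rw [p.coe_add, map_add, map_add, hy, hz]

/-- A multiplicative conditional expectation, as a `*`-homomorphism. -/
noncomputable def ConditionalExpectation.toStarAlgHom {A B : Type*} [CStarAlgebra A]
    [PartialOrder A] [StarOrderedRing A] [CStarAlgebra B] [PartialOrder B] [StarOrderedRing B]
    {j : B →⋆ₐ[ℂ] A} (E : ConditionalExpectation j) (hE : ∀ a a', E (a * a') = E a * E a') :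
    A →⋆ₐ[ℂ] B where
  toFun := E
  map_one' := E.apply_one
  map_mul' := hE
  map_zero' := map_zero _
  map_add' := map_add _
  commutes' c := by
    rw [Algebra.algebraMap_eq_smul_one, map_smul, E.apply_one, Algebra.algebraMap_eq_smul_one]
  map_star' := E.apply_star

/-! ### The Hilbert modules of multiplicative conditional expectations -/

namespace VertexModule

open Word ModuleKernel

variable {ι : Type} {A : ι → Type*} {B : Type*} [∀ k, CStarAlgebra (A k)]
  [∀ k, PartialOrder (A k)] [∀ k, StarOrderedRing (A k)]
  [CStarAlgebra B] [PartialOrder B] [StarOrderedRing B]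
  {j : ∀ k, B →⋆ₐ[ℂ] A k} {E : ∀ k, ConditionalExpectation (j k)} {k m l : ι}

theorem admissible_last (a : A l) : (last a : Word A l l m).Admissible E := by
  rw [Admissible]; trivial

theorem gram_cons_cons_eq_zero (hE : ∀ k a a', E k (a * a') = E k a * E k a') (b : B) :
    ∀ {k m : ι} (w : Word A l k m) (a : A k) {c : A m} (_ : E m c = 0) (t : Word A l k m),
    gram E b w (cons a (cons c t)) = 0
  | _, _, last _, _, _, _, _ => by simp only [gram]
  | _, _, cons _ (last _), _, _, _, _ => by simp only [gram]
  | _, _, cons _ (cons _ _), _, _, hc, _ => by simp only [gram, hE, hc, mul_zero, gram_zero]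

theorem toModule_vec_cons_cons (hE : ∀ k a a', E k (a * a') = E k a * E k a') (a : A k) {c : A m}
    (hc : E m c = 0) (t : Word A l k m) (h : (cons a (cons c t)).Admissible E) :
    (kernel E k m l).toModule (vec (cons a (cons c t)) h) = 0 := by
  rw [← map_zero (kernel E k m l).toModule]
  refine toModule_eq fun z => ?_
  rw [map_zero]
  refine Pre.induction (kernel E k m l)
    (Q := fun z => (kernel E k m l).ip z (vec (cons a (cons c t)) h) = 0) (by simp)
    (fun x y hx hy => by rw [map_add, LinearMap.add_apply, hx, hy, add_zero]) (fun d s => ?_) z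
  rw [LinearMap.map_smulₛₗ, LinearMap.smul_apply]
  exact (congrArg _ ((ip_vec s.word _ s.admissible h).trans
    (gram_cons_cons_eq_zero hE 1 s.word a hc t))).trans (smul_zero _)

theorem U_coe (x : (kernel E k m l).Pre) :
    U E k m l ((kernel E k m l).toModule x) = (kernel E m k l).toModule (uPre x) :=
  mapL_coe _ _

theorem lam_coe (c : A k) (x : (kernel E k m l).Pre) :
    (lam E k m l c).1 ((kernel E k m l).toModule x) = (kernel E k m l).toModule (lamPre c x) :=
  lamOp_coe c x

theorem lam'_apply (c : A m) (x : H E k m l) :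
    (lam' E k m l c).1 x = U E m k l ((lam E m k l c).1 (U E k m l x)) := rfl

/-- On tensors `a` of length one, `lam' c a = 1 ⊗ (c - E c) ⊗ a + (E c) a`, where the first summand
vanishes. There are no tensors of length two, as their last entry would be in `A m`, and all longer
ones vanish. -/
theorem lam'_eq_lam (hE : ∀ k a a', E k (a * a') = E k a * E k a') (hkm : k ≠ m) (c : A m) :
    lam' E k m k c = lam E k m k (j k (E m c)) := by
  refine Adjointable.ext_apply <| mapL_ext fun x => ?_
  refine LinearMap.congr_fun
    (f := (lam' E k m k c).1.toLinearMap ∘ₗ (kernel E k m k).toModule.toLinearMap)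
    (g := (lam E k m k (j k (E m c))).1.toLinearMap ∘ₗ (kernel E k m k).toModule.toLinearMap)
    (ModuleKernel.hom_ext _ fun s => ?_) x
  obtain ⟨w, hw⟩ := s
  change (lam' E k m k c).1 ((kernel E k m k).toModule (vec w hw)) =
    (lam E k m k (j k (E m c))).1 ((kernel E k m k).toModule (vec w hw))
  match m, w, hw with
  | m, last a, hw =>
    rw [lam'_apply, U_coe, lam_coe, U_coe, uPre_vec, uElem_last, lam_coe]
    have e1 : lamPre c (vec (cons 1 (last a)) (admissible_cons_last (E := E) 1 a)) =
        vec (cons (c * 1) (last a)) (admissible_cons_last (c * 1) a) := lamPre_gen _ _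
    have e2 : lamPre (j k (E m c)) (vec (last a : Word A k k m) hw) =
        vec (last (j k (E m c) * a)) (admissible_last _) := lamPre_gen _ _
    rw [e1, e2, uPre_vec, uElem_cons, map_add,
      toModule_vec_cons_cons hE 1 ((E m).apply_sub_self _), zero_add]
    simp only [Word.lmul, mul_one]
  | _, cons a (last b), _ => exact absurd rfl hkm
  | m, cons a (cons b t), hw =>
    rw [toModule_vec_cons_cons hE a hw.1, map_zero, map_zero]

theorem lam_injective : Function.Injective (lam E k m k) := fun a a' h => by
  have h1 : ∀ a : A k, (lam E k m k a).1 ((kernel E k m k).toModule (vec (last 1) (admissible_last 1))) =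
      (kernel E k m k).toModule (vec (last (a * 1)) (admissible_last _)) := fun a =>
    (lam_coe a _).trans (congrArg _ (lamPre_gen _ _))
  have h2 := h1 a
  rw [h, h1 a'] at h2
  have h3 : ∀ a : A k, (kernel E k m k).hip ((kernel E k m k).toModule (vec (last 1) (admissible_last 1)))
      ((kernel E k m k).toModule (vec (last (a * 1)) (admissible_last _))) = a := fun a => by
    rw [hip_coe, ip_vec]
    simp only [gram, star_one, map_one, mul_one, one_mul]
  rw [← h3 a, ← h3 a', h2]

theorem norm_lam (a : A k) : ‖lam E k m k a‖ = ‖a‖ :=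
  NonUnitalStarAlgHom.norm_map (lam E k m k) lam_injective a

end VertexModule

/-! ### The map to the fiber sum -/

section FiberSum

variable {A : Fin 2 → Type*} {B : Type*} [∀ k, CStarAlgebra (A k)]
  [∀ k, PartialOrder (A k)] [∀ k, StarOrderedRing (A k)]
  [CStarAlgebra B] [PartialOrder B] [StarOrderedRing B]
  {j : ∀ k, B →⋆ₐ[ℂ] A k} {E : ∀ k, ConditionalExpectation (j k)}
  (hE : ∀ k a a', E k (a * a') = E k a * E k a')

/-- The identity of `A 0`, and the homomorphism `A 1 → B → A 0`. -/
noncomputable def retractionGen₀ : ∀ i, A i →⋆ₐ[ℂ] A 0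
  | 0 => StarAlgHom.id ℂ (A 0)
  | 1 => (j 0).comp ((E 1).toStarAlgHom (hE 1))

/-- The identity of `A 1`, and the homomorphism `A 0 → B → A 1`. -/
noncomputable def retractionGen₁ : ∀ i, A i →⋆ₐ[ℂ] A 1
  | 0 => (j 1).comp ((E 0).toStarAlgHom (hE 0))
  | 1 => StarAlgHom.id ℂ (A 1)

theorem retractionGen₀_incl (b : B) : ∀ i, retractionGen₀ hE i (j i b) = j 0 b
  | 0 => rfl
  | 1 => congrArg (j 0) ((E 1).apply_incl b)

theorem retractionGen₁_incl (b : B) : ∀ i, retractionGen₁ hE i (j i b) = j 1 b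
  | 0 => congrArg (j 1) ((E 0).apply_incl b)
  | 1 => rfl

/-- The retraction of the full amalgamated free product onto `A 0` that is `E 1` on `A 1`. -/
noncomputable def retraction₀ : FullAmalgam j →⋆ₐ[ℂ] A 0 :=
  FullAmalgam.lift (retractionGen₀ hE) fun i i' b => by
    rw [retractionGen₀_incl, retractionGen₀_incl]

/-- The retraction of the full amalgamated free product onto `A 1` that is `E 0` on `A 0`. -/
noncomputable def retraction₁ : FullAmalgam j →⋆ₐ[ℂ] A 1 :=
  FullAmalgam.lift (retractionGen₁ hE) fun i i' b => by
    rw [retractionGen₁_incl, retractionGen₁_incl]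

theorem retraction₀_of_zero (a : A 0) : retraction₀ hE (FullAmalgam.of j 0 a) = a :=
  FullAmalgam.lift_of _ _ _ _

theorem retraction₀_of_one (a : A 1) : retraction₀ hE (FullAmalgam.of j 1 a) = j 0 (E 1 a) :=
  FullAmalgam.lift_of _ _ _ _

theorem retraction₁_of_zero (a : A 0) : retraction₁ hE (FullAmalgam.of j 0 a) = j 1 (E 0 a) :=
  FullAmalgam.lift_of _ _ _ _

theorem retraction₁_of_one (a : A 1) : retraction₁ hE (FullAmalgam.of j 1 a) = a :=
  FullAmalgam.lift_of _ _ _ _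

theorem vertexRep₀_eq (x : FullAmalgam j) :
    vertexRep₀ E x = VertexModule.lam E 0 1 0 (retraction₀ hE x) := by
  refine DFunLike.congr_fun (f := vertexRep₀ E)
    (g := (VertexModule.lam E 0 1 0).comp (retraction₀ hE)) (FullAmalgam.hom_ext fun i a => ?_) x
  rw [StarAlgHom.comp_apply]
  refine (FullAmalgam.lift_of _ _ _ _).trans ?_
  match i, a with
  | 0, a => rw [retraction₀_of_zero]; rfl
  | 1, a => rw [retraction₀_of_one]; exact VertexModule.lam'_eq_lam hE zero_ne_one a

theorem vertexRep₁_eq (x : FullAmalgam j) :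
    vertexRep₁ E x = VertexModule.lam E 1 0 1 (retraction₁ hE x) := by
  refine DFunLike.congr_fun (f := vertexRep₁ E)
    (g := (VertexModule.lam E 1 0 1).comp (retraction₁ hE)) (FullAmalgam.hom_ext fun i a => ?_) x
  rw [StarAlgHom.comp_apply]
  refine (FullAmalgam.lift_of _ _ _ _).trans ?_
  match i, a with
  | 0, a => rw [retraction₁_of_zero]; exact VertexModule.lam'_eq_lam hE one_ne_zero a
  | 1, a => rw [retraction₁_of_one]; rfl

/-- The pair of the two retractions. -/
noncomputable def toFiberSum : FullAmalgam j →⋆ₐ[ℂ] A 0 × A 1 :=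
  (retraction₀ hE).prod (retraction₁ hE)

theorem toFiberSum_of_zero (a : A 0) :
    toFiberSum hE (FullAmalgam.of j 0 a) = (a, j 1 (E 0 a)) :=
  Prod.ext (retraction₀_of_zero hE a) (retraction₁_of_zero hE a)

theorem toFiberSum_of_one (a : A 1) :
    toFiberSum hE (FullAmalgam.of j 1 a) = (j 0 (E 1 a), a) :=
  Prod.ext (retraction₀_of_one hE a) (retraction₁_of_one hE a)

theorem vertexSeminorm_eq_norm_toFiberSum (x : FullAmalgam j) :
    vertexSeminorm E x = ‖toFiberSum hE x‖ := by
  rw [vertexSeminorm_apply, vertexRep₀_eq hE, vertexRep₁_eq hE, VertexModule.norm_lam,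
    VertexModule.norm_lam]
  rfl

theorem toFiberSum_mem (x : FullAmalgam j) : toFiberSum hE x ∈ fiberSum E hE := by
  refine DFunLike.congr_fun (f := ((E 0).toStarAlgHom (hE 0)).comp (retraction₀ hE))
    (g := ((E 1).toStarAlgHom (hE 1)).comp (retraction₁ hE)) (FullAmalgam.hom_ext fun i a => ?_) x
  rw [StarAlgHom.comp_apply, StarAlgHom.comp_apply]
  match i, a with
  | 0, a =>
    rw [retraction₀_of_zero, retraction₁_of_zero]
    exact ((E 1).apply_incl _).symm
  | 1, a =>
    rw [retraction₀_of_one, retraction₁_of_one]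
    exact (E 0).apply_incl _

/-- The element `a₀ + a₁ - b` of the full amalgamated free product, where `b = E 0 a₀`. -/
noncomputable def fiberSumLift (x : A 0 × A 1) : FullAmalgam j :=
  FullAmalgam.of j 0 x.1 + FullAmalgam.of j 1 x.2 - FullAmalgam.of j 0 (j 0 (E 0 x.1))

theorem toFiberSum_fiberSumLift {x : A 0 × A 1} (hx : x ∈ fiberSum E hE) :
    toFiberSum hE (fiberSumLift (E := E) x) = x := by
  rw [fiberSumLift, map_sub, map_add, toFiberSum_of_zero, toFiberSum_of_one, toFiberSum_of_zero,
    (E 0).apply_incl, ← (mem_fiberSum E hE x).1 hx, Prod.mk_add_mk, Prod.mk_sub_mk,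
    add_sub_cancel_right, add_sub_cancel_left]

theorem isClosed_fiberSum : IsClosed (fiberSum E hE : Set (A 0 × A 1)) := by
  have hc : ∀ k, Continuous (E k) := fun k =>
    AddMonoidHomClass.continuous_of_bound ((E k).toStarAlgHom (hE k)) 1 fun x => by
      rw [one_mul]; exact NonUnitalStarAlgHom.norm_apply_le _ x
  exact isClosed_eq ((hc 0).comp continuous_fst) ((hc 1).comp continuous_snd)

/-- The homomorphism of the vertex-reduced product to `A 0 × A 1` induced by the two
retractions. -/
noncomputable def reducedToProd : VertexReduced E →⋆ₐ[ℂ] A 0 × A 1 :=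
  CStarSeminorm.lift (toFiberSum hE) fun x => (vertexSeminorm_eq_norm_toFiberSum hE x).ge

theorem reducedToProd_mk (x : FullAmalgam j) :
    reducedToProd hE (VertexReduced.mk E x) = toFiberSum hE x :=
  CStarSeminorm.lift_toCompletion _ _ x

theorem continuous_reducedToProd : Continuous (reducedToProd hE) :=
  AddMonoidHomClass.continuous_of_bound (reducedToProd hE) 1 fun x => by
    rw [one_mul]; exact NonUnitalStarAlgHom.norm_apply_le _ x

theorem reducedToProd_mem (y : VertexReduced E) : reducedToProd hE y ∈ fiberSum E hE := by
  refine CStarSeminorm.induction _ (Q := fun y => reducedToProd hE y ∈ fiberSum E hE)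
    ((isClosed_fiberSum hE).preimage (continuous_reducedToProd hE)) (fun x => ?_) y
  exact (reducedToProd_mk hE x).symm ▸ toFiberSum_mem hE x

theorem norm_reducedToProd (y : VertexReduced E) : ‖reducedToProd hE y‖ = ‖y‖ := by
  refine CStarSeminorm.induction _ (Q := fun y => ‖reducedToProd hE y‖ = ‖y‖)
    (isClosed_eq (continuous_reducedToProd hE).norm continuous_norm) (fun x => ?_) y
  rw [CStarSeminorm.norm_coe, vertexSeminorm_eq_norm_toFiberSum hE]
  exact congrArg _ (reducedToProd_mk hE x)

theorem reducedToProd_injective : Function.Injective (reducedToProd hE) :=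
  (injective_iff_map_eq_zero _).2 fun y hy => by
    rw [← norm_eq_zero, ← norm_reducedToProd hE, hy, norm_zero]

/-- The isomorphism of the vertex-reduced product with the fiber sum. -/
noncomputable def reducedEquivFiberSum : VertexReduced E ≃⋆ₐ[ℂ] fiberSum E hE :=
  StarAlgEquiv.ofBijective
    (StarAlgHom.codRestrict (reducedToProd hE) (fiberSum E hE) (reducedToProd_mem hE))
    ⟨(StarAlgHom.injective_codRestrict _ _ _).2 (reducedToProd_injective hE), fun x =>
      ⟨VertexReduced.mk E (fiberSumLift (E := E) x.1), Subtype.ext <|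
        (reducedToProd_mk hE _).trans (toFiberSum_fiberSumLift hE x.2)⟩⟩

theorem reducedEquivFiberSum_mk (x : FullAmalgam j) :
    (reducedEquivFiberSum hE (VertexReduced.mk E x) : A 0 × A 1) = toFiberSum hE x :=
  reducedToProd_mk hE x

/-- Every element of the vertex-reduced product is the class of some `a₀ + a₁ - b`. -/
theorem exists_mk_fiberSumLift (hE : ∀ k a a', E k (a * a') = E k a * E k a')
    (y : VertexReduced E) :
    ∃ x : A 0 × A 1, y = VertexReduced.mk E (fiberSumLift (E := E) x) :=
  ⟨reducedToProd hE y, reducedToProd_injective hE <| by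
    rw [reducedToProd_mk, toFiberSum_fiberSumLift hE (reducedToProd_mem hE y)]⟩

end FiberSum

/-- If both conditional expectations are homomorphisms, then the vertex-reduced amalgamated free
product is canonically isomorphic to the fiber sum. -/
theorem mainTheorem5 {A : Fin 2 → Type*} {B : Type*} [∀ k, CStarAlgebra (A k)]
    [∀ k, PartialOrder (A k)] [∀ k, StarOrderedRing (A k)]
    [CStarAlgebra B] [PartialOrder B] [StarOrderedRing B]
    (j : ∀ k, B →⋆ₐ[ℂ] A k) (E : ∀ k, ConditionalExpectation (j k))
    (hE : ∀ k a a', E k (a * a') = E k a * E k a') :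
    ∃! φ : VertexReduced E ≃⋆ₐ[ℂ] fiberSum E hE,
      (∀ a : A 0, (φ (VertexReduced.mk E (FullAmalgam.of j 0 a)) : A 0 × A 1) = (a, j 1 (E 0 a))) ∧
      (∀ a : A 1, (φ (VertexReduced.mk E (FullAmalgam.of j 1 a)) : A 0 × A 1) = (j 0 (E 1 a), a)) := by
  refine ⟨reducedEquivFiberSum hE, ⟨fun a => ?_, fun a => ?_⟩, fun ψ hψ => ?_⟩
  · rw [reducedEquivFiberSum_mk, toFiberSum_of_zero]
  · rw [reducedEquivFiberSum_mk, toFiberSum_of_one]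
  · refine StarAlgEquiv.ext fun y => ?_
    obtain ⟨x, rfl⟩ := exists_mk_fiberSumLift hE y
    have h0 : ∀ a : A 0, ψ (VertexReduced.mk E (FullAmalgam.of j 0 a)) =
        reducedEquivFiberSum hE (VertexReduced.mk E (FullAmalgam.of j 0 a)) := fun a =>
      Subtype.ext <| by rw [hψ.1, reducedEquivFiberSum_mk, toFiberSum_of_zero]
    have h1 : ∀ a : A 1, ψ (VertexReduced.mk E (FullAmalgam.of j 1 a)) =
        reducedEquivFiberSum hE (VertexReduced.mk E (FullAmalgam.of j 1 a)) := fun a =>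
      Subtype.ext <| by rw [hψ.2, reducedEquivFiberSum_mk, toFiberSum_of_one]
    simp only [fiberSumLift, map_sub, map_add, h0, h1]
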